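/- **Setting.** Let $\mathscr B\subseteq\{w:\mathbb N\to\mathbb R^{q}\}$, $q=m+p$, be a discrete-time linear time-invariant system with variables $w_t=(u_t,y_t)$, $m$ inputs $u$, $p$ outputs $y$, order $n$ (least state dimension of an input/state/output representation) and lag $\ell$ (least degree of a kernel representation $\mathscr B=\ker R(\sigma)$). $\mathscr B|_T$ denotes the set of windows $(w_0,\dots,w_{T-1})$ of its trajectories (also viewed as stacked vectors in $\mathbb R^{qT}$), $\mathscr H_d(w)\in\mathbb R^{qd\times(T-d+1)}$ the Hankel matrix of depth $d\le T$ of $w=(w_0,\dots,w_{T-1})$, $s_i(\cdot)$ the $i$-th largest singular value, $\|\cdot\|_F$ the Frobenius norm, and $\mathrm{null}(M)$ any matrix whose columns form an orthonormal basis of $\ker M$. For $R=[r_{i,0}\ \cdots\ r_{i,d-1}]_{i=1,\dots,pd-n}$ with $r_{i,j}\in\mathbb R^{1\times q}$, let $\Gamma(R)$ be the matrix with $q(L+n)$ columns whose rows are $[r_{i,0}\ \cdots\ r_{i,d-1}\ 0\ \cdots\ 0]$ for all $i$, followed by the rows obtained by shifting these to the right by $1,\dots,L+n-d$ blocks of $q$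 entries for $i=1,\dots,p$ only. **Data.** Let $w\in\mathscr B|_T$ and $\widetilde w_k=w_k+(0,\varepsilon_k)$ with $\varepsilon_k\in\mathbb R^p$, $\|\varepsilon_k\|_\infty\le\bar\varepsilon$. Let $L\ge d\ge\ell+1$ and $\mathrm{rank}\,\mathscr H_d(\widetilde w)\ge\mathrm{rank}\,\mathscr H_d(w)=md+n$. Let $\widehat{\mathscr H}$ be a truncated singular value decomposition of $\mathscr H_d(\widetilde w)$ that keeps the $md+n$ largest singular values, let $\widehat R_d=\mathrm{null}(\widehat{\mathscr H}^\top)^\top$, $\widehat\Gamma=\Gamma(\widehat R_d)$ and $\widehat P=\mathrm{null}(\widehat\Gamma)$. **Noise-free reference.** Call $R_d=\mathrm{null}(\mathscr H_d(w)^\top)^\top$ *matched* to $\widehat R_d$ if $\|\widehat R_d-R_d\|_F\le 2\sqrt{md+n}\,\|\sin\Theta\|_F$, where $\Theta$ is the diagonal matrix of the principal angles between the left null spaces of $\widehat{\mathscr H}$ and $\mathscr H_d(w)$. Put $$C_\theta=8\sqrt{qd(L+n-d+1)(md+n)(T-d+1)},\quad \rho_1=4\sqrt{L+n-d+1}\,\sqrt{2qd(md+n)(T-d+1)},\quad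 \rho_2=2\sqrt{qd(T-d+1)} .$$ **Claim.** A matched $R_d$ exists. For every matched $R_d$, with $\Gamma=\Gamma(R_d)$ and $\bar\rho_1=\rho_1/s_{p(L+n)-n}(\Gamma)$: if $s_{p(L+n)-n}(\Gamma)>0$ and $s_{md+n}(\mathscr H_d(w))>(\bar\rho_1+\rho_2)\bar\varepsilon$, then there is a matrix $P$ of the size of $\widehat P$, with linearly independent columns, such that $\mathrm{im}(P)=\mathscr B|_{L+n}$ and $$\|\widehat P-P\|_F\le\frac{2\sqrt{m(L+n)+n}\;C_\theta/s_{p(L+n)-n}(\Gamma)}{s_{md+n}(\mathscr H_d(w))-(\bar\rho_1+\rho_2)\bar\varepsilon}\,\bar\varepsilon ,$$ and for fixed $s_{p(L+n)-n}(\Gamma)$ and $s_{md+n}(\mathscr H_d(w))$ the right-hand side, as a function of $\bar\varepsilon$, tends to $0$ as $\bar\varepsilon\to0$. -/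

import Mathlib

open Filter Topology Matrix
open scoped Matrix.Norms.Frobenius

/-- Index set of the `q = m + p` system variables: `Sum.inl` are the inputs `u`,
`Sum.inr` are the outputs `y`, so that `w_t = (u_t, y_t)`. -/
abbrev Sig (m p : ℕ) : Type := Fin m ⊕ Fin p

/-- The behavior of the input/state/output system `x⁺ = A x + B u`, `y = C x + D u`
on the time axis `ℕ` (with free initial state). -/
def ssBehavior {m p N : ℕ} (A : Matrix (Fin N) (Fin N) ℝ) (B : Matrix (Fin N) (Fin m) ℝ)
    (C : Matrix (Fin p) (Fin N) ℝ) (D : Matrix (Fin p) (Fin m) ℝ) :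
    Set (ℕ → Sig m p → ℝ) :=
  {w | ∃ x : ℕ → Fin N → ℝ, ∀ k,
    x (k + 1) = A *ᵥ x k + B *ᵥ (fun i => w k (Sum.inl i)) ∧
    (fun i => w k (Sum.inr i)) = C *ᵥ x k + D *ᵥ (fun i => w k (Sum.inl i))}

/-- `ker R(σ)`: the solutions `w : ℕ → ℝ^q` of `R(σ) w = 0`, for a polynomial matrix `R(z)`,
where `σ` is the shift `(σ w)(k) = w (k + 1)`. -/
def kerBehavior {m p g : ℕ} (R : Matrix (Fin g) (Sig m p) (Polynomial ℝ)) :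
    Set (ℕ → Sig m p → ℝ) :=
  {w | ∀ (k : ℕ) (i : Fin g), ∑ v, (R i v).sum (fun j c => c * w (k + j) v) = 0}

/-- `𝓑` is a discrete-time LTI system with `m` inputs, `p` outputs, order `n` (the least
dimension of the state of an input/state/output representation) and lag `l` (the least degree
of a kernel representation). -/
structure IsLTI (m p n l : ℕ) (𝓑 : Set (ℕ → Sig m p → ℝ)) : Prop where
  order : IsLeast {N : ℕ | ∃ (A : Matrix (Fin N) (Fin N) ℝ) (B : Matrix (Fin N) (Fin m) ℝ)
    (C : Matrix (Fin p) (Fin N) ℝ) (D : Matrix (Fin p) (Fin m) ℝ), 𝓑 = ssBehavior A B C D} n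
  lag : IsLeast {N : ℕ | ∃ (g : ℕ) (R : Matrix (Fin g) (Sig m p) (Polynomial ℝ)),
    (∀ i v, (R i v).natDegree ≤ N) ∧ 𝓑 = kerBehavior R} l

/-- The restricted behavior `𝓑|_T`: the windows `(w_0, …, w_{T-1})` of trajectories of `𝓑`. -/
def restrict {m p : ℕ} (𝓑 : Set (ℕ → Sig m p → ℝ)) (T : ℕ) : Set (Fin T → Sig m p → ℝ) :=
  (fun (v : ℕ → Sig m p → ℝ) (t : Fin T) => v t) '' 𝓑

/-- The Hankel matrix of depth `d` of `w_0, …, w_{T-1}`. It has `T - d + 1` columns, and its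
`j`-th column is the stacked window `w_j, …, w_{j+d-1}`. -/
def hankel {m p T : ℕ} (d : ℕ) (w : Fin T → Sig m p → ℝ) :
    Matrix (Fin d × Sig m p) (Fin (T + 1 - d)) ℝ :=
  fun a j => w ⟨j + a.1, by have := j.isLt; have := a.1.isLt; omega⟩ a.2

/-- The measurements `w̃_k = (u_k, y_k + ε_k)`. -/
def addOutputNoise {m p T : ℕ} (w : Fin T → Sig m p → ℝ) (ε : Fin T → Fin p → ℝ) :
    Fin T → Sig m p → ℝ :=
  fun k => w k + Sum.elim (fun _ => 0) (ε k)

section LinearAlgebra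

variable {ι κ : Type} [Fintype ι] [DecidableEq ι] [Fintype κ] [DecidableEq κ]

/-- `s_i(M)`: the `i`-th largest singular value of `M`, counted from `i = 1`
(Mathlib counts from `0`). -/
noncomputable def sv (M : Matrix ι κ ℝ) (i : ℕ) : ℝ :=
  (Matrix.toEuclideanLin M).singularValues (i - 1)

/-- `N = null(M)`: the columns of `N` form an orthonormal basis of the kernel of `M`. -/
def IsNull {γ : Type} [Fintype γ] [DecidableEq γ]
    (N : Matrix κ γ ℝ) (M : Matrix ι κ ℝ) : Prop :=
  Nᵀ * N = 1 ∧ LinearMap.range N.mulVecLin = LinearMap.ker M.mulVecLin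

/-- `Mhat = U S₁ Vᵀ` is a rank-`r` truncated singular value decomposition of
`M = [U W] diag(S₁, S₂) [V Q]ᵀ`, where `S₁` holds the `r` largest singular values of `M`,
`S₂` the next ones, and `[U W]`, `[V Q]` have orthonormal columns. -/
def IsTSVD (r : ℕ) (M Mhat : Matrix ι κ ℝ) : Prop :=
  ∃ (k : ℕ) (U : Matrix ι (Fin r) ℝ) (W : Matrix ι (Fin k) ℝ)
    (V : Matrix κ (Fin r) ℝ) (Q : Matrix κ (Fin k) ℝ),
    (fromCols U W)ᵀ * fromCols U W = 1 ∧
    (fromCols V Q)ᵀ * fromCols V Q = 1 ∧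
    M = fromCols U W *
      diagonal (Sum.elim (fun i : Fin r => sv M (i + 1)) (fun j : Fin k => sv M (r + j + 1))) *
      (fromCols V Q)ᵀ ∧
    Mhat = U * diagonal (fun i : Fin r => sv M (i + 1)) * Vᵀ

/-- `x_1, …, x_k` and `y_1, …, y_k` are principal vectors of the `k`-dimensional subspaces
`X` and `Y`: the pair `(x_i, y_i)` maximizes the inner product over all pairs of unit vectors of
`X` and `Y` that are orthogonal to the previous `x_j` and `y_j`, respectively. -/
structure IsPrincipalVectors {k : ℕ} (X Y : Submodule ℝ (ι → ℝ)) (x y : Fin k → ι → ℝ) :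
    Prop where
  finrank_left : Module.finrank ℝ X = k
  finrank_right : Module.finrank ℝ Y = k
  mem_left : ∀ i, x i ∈ X
  mem_right : ∀ i, y i ∈ Y
  unit_left : ∀ i, x i ⬝ᵥ x i = 1
  unit_right : ∀ i, y i ⬝ᵥ y i = 1
  orth_left : ∀ i j, j < i → x i ⬝ᵥ x j = 0
  orth_right : ∀ i j, j < i → y i ⬝ᵥ y j = 0
  maximal : ∀ i, ∀ a ∈ X, ∀ b ∈ Y, a ⬝ᵥ a = 1 → b ⬝ᵥ b = 1 →
    (∀ j < i, a ⬝ᵥ x j = 0) → (∀ j < i, b ⬝ᵥ y j = 0) → a ⬝ᵥ b ≤ x i ⬝ᵥ y i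

/-- `θ_1, …, θ_k` are the principal angles between the `k`-dimensional subspaces `X` and `Y`. -/
def IsPrincipalAngles {k : ℕ} (X Y : Submodule ℝ (ι → ℝ)) (θ : Fin k → ℝ) : Prop :=
  ∃ x y : Fin k → ι → ℝ, IsPrincipalVectors X Y x y ∧ ∀ i, θ i = Real.arccos (x i ⬝ᵥ y i)

/-- The rows of `R` form an orthonormal basis of the left null space of `H` that is matched to
the given orthonormal basis `Rhat` of the left null space of `Hhat`, in the sense that
`‖Rhat - R‖_F ≤ 2 √r ‖sin Θ‖_F` with `Θ` the diagonal matrix of the principal angles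
between these two left null spaces. -/
def IsMatchedLeftNull {g : ℕ} (r : ℕ) (Hhat H : Matrix ι κ ℝ) (Rhat R : Matrix (Fin g) ι ℝ) :
    Prop :=
  IsNull Rᵀ Hᵀ ∧
  ∃ θ : Fin g → ℝ,
    IsPrincipalAngles (LinearMap.ker Hhatᵀ.mulVecLin) (LinearMap.ker Hᵀ.mulVecLin) θ ∧
    ‖Rhat - R‖ ≤ 2 * √(r : ℝ) * ‖diagonal (fun i => Real.sin (θ i))‖

end LinearAlgebra

/-- The block row `[0 ⋯ 0 r_{i,0} r_{i,1} ⋯ r_{i,d-1} 0 ⋯ 0]` of length `M` with `s` leading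
zero blocks, for the `i`-th row `[r_{i,0} ⋯ r_{i,d-1}]` of `R`. -/
def shiftedRow {m p g d : ℕ} (M : ℕ) (R : Matrix (Fin g) (Fin d × Sig m p) ℝ) (s : ℕ)
    (i : Fin g) : Fin M × Sig m p → ℝ :=
  fun a => if h : s ≤ (a.1 : ℕ) ∧ (a.1 : ℕ) - s < d then R i (⟨a.1 - s, h.2⟩, a.2) else 0

/-- The matrix `Γ` with `M` block columns: all rows of `R` without shift, followed by the first
`p` rows of `R` shifted by `1, …, M - d` blocks. -/
def gammaMat {m p g d : ℕ} (M : ℕ) (R : Matrix (Fin g) (Fin d × Sig m p) ℝ) :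
    Matrix (Fin g ⊕ (Fin (M - d) × {i : Fin g // (i : ℕ) < p})) (Fin M × Sig m p) ℝ :=
  fun a => match a with
    | Sum.inl i => shiftedRow M R 0 i
    | Sum.inr (s, i) => shiftedRow M R (s + 1) i

/-- `C_θ = 8 √(q d (L+n-d+1) (md+n) (T-d+1))` with `q = m + p`. -/
noncomputable def Ctheta (m p n d L T : ℕ) : ℝ :=
  8 * √(((m : ℝ) + p) * d * ((L : ℝ) + n - d + 1) * ((m : ℝ) * d + n) * ((T : ℝ) - d + 1))

/-- `ρ₁ = 4 √(L+n-d+1) √(2 q d (md+n) (T-d+1))` with `q = m + p`. -/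
noncomputable def rho1 (m p n d L T : ℕ) : ℝ :=
  4 * √((L : ℝ) + n - d + 1) *
    √(2 * ((m : ℝ) + p) * d * ((m : ℝ) * d + n) * ((T : ℝ) - d + 1))

/-- `ρ₂ = 2 √(q d (T-d+1))` with `q = m + p`. -/
noncomputable def rho2 (m p d T : ℕ) : ℝ :=
  2 * √(((m : ℝ) + p) * d * ((T : ℝ) - d + 1))

/-- The error bound
`(2 √(m(L+n)+n) C_θ / s_Γ) / (s_H - (ρ₁ / s_Γ + ρ₂) e) * e` at noise level `e`. -/
noncomputable def basisErrorBound (m p n d L T : ℕ) (sΓ sH e : ℝ) : ℝ :=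
  (2 * √((m : ℝ) * ((L : ℝ) + n) + n) * Ctheta m p n d L T / sΓ) /
    (sH - (rho1 m p n d L T / sΓ + rho2 m p d T) * e) * e

/-!
The columns of the noise-free Hankel matrix `H` span all windows of length `d` of the system: by
the state-space representation these form a space of dimension at most `md + n`, which is the rank
of `H` (`range_hankel_eq`). Equality of the dimensions also shows that a window of length `d`, and
hence any longer one, determines the initial state and the input, so that the windows of length
`L + n` form a space of dimension `m(L+n) + n` (`windowMap_injective_mono`). They are annihilated
by `Γ(R)`, and `s_{p(L+n)-n}(Γ(R)) > 0` says that the kernel of `Γ(R)` is no larger; hence it is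
exactly `𝓑|_{L+n}` (`range_windowMap_eq_ker_gammaMat`).

The perturbation bound is a chain of three estimates. Let `E` be the Hankel matrix of the noise,
so `‖E‖ ≤ √(qd(T-d+1)) εbar = ρ₂ εbar / 2`.
* Wedin's theorem for the left null spaces (`norm_sin_le_of_isTSVD`) together with Weyl's
  inequality gives `‖sin Θ‖ ≤ ‖E‖ / (s_{md+n}(H) - ‖E‖) ≤ 2 ‖E‖ / s_{md+n}(H)`.
* Each row of `R` occurs at most `L + n - d + 1` times in `Γ(R)`, so `Γ` expands distances by at
  most the square root of this number (`norm_gammaMat_sq_le`); with the matching inequality this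
  bounds `‖Γ(Rhat) - Γ(R)‖`, and the gap condition makes it smaller than `s_{p(L+n)-n}(Γ(R))`.
* `P` is the orthogonal projection of `Phat` to `ker Γ(R)`: for it
  `s_{p(L+n)-n}(Γ(R)) ‖Phat - P‖ ≤ ‖Γ(Rhat) - Γ(R)‖` (`exists_mul_eq_zero_near`). So
  `‖Phat - P‖ < 1`, which makes the columns of `P` independent, and they span `ker Γ(R)` because
  `Γ(Rhat)` has at most `p(L+n) - n` rows, so that `Phat` has at least `m(L+n) + n` columns.

A matched `R` is obtained by expressing `Rhat` in principal vectors of its row space and replacing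
these by the corresponding principal vectors of the left null space of `H`
(`exists_isMatchedLeftNull`); this gives the constant `√2`, which is at most `2 √(md+n)` unless
`md + n = 0`, when both left null spaces are the whole space.
-/

/-! ### Frobenius norm -/

theorem frobenius_sq {ι κ : Type} [Fintype ι] [Fintype κ] (M : Matrix ι κ ℝ) :
    ‖M‖ ^ 2 = ∑ i, ∑ j, M i j ^ 2 := by
  have h0 : 0 ≤ ∑ i, ∑ j, M i j ^ 2 := by positivity
  rw [frobenius_norm_def, ← Real.sqrt_eq_rpow, Real.sq_sqrt (by positivity)]
  simp

theorem frobenius_sq_rows {ι κ : Type} [Fintype ι] [Fintype κ] (M : Matrix ι κ ℝ) :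
    ‖M‖ ^ 2 = ∑ i, M i ⬝ᵥ M i := by
  rw [frobenius_sq]
  simp only [dotProduct, pow_two]

theorem frobenius_sq_cols {ι κ : Type} [Fintype ι] [Fintype κ] (M : Matrix ι κ ℝ) :
    ‖M‖ ^ 2 = ∑ j, M.col j ⬝ᵥ M.col j := by
  rw [← frobenius_norm_transpose, frobenius_sq_rows]; rfl

theorem dotProduct_self_nonneg_real {ι : Type} [Fintype ι] (a : ι → ℝ) : 0 ≤ a ⬝ᵥ a :=
  Finset.sum_nonneg fun _ _ => mul_self_nonneg _

theorem norm_toLp_sq {ι : Type} [Fintype ι] (a : ι → ℝ) :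
    ‖WithLp.toLp 2 a‖ ^ 2 = a ⬝ᵥ a := by
  rw [EuclideanSpace.real_norm_sq_eq]
  simp only [dotProduct, pow_two]

/-- Bessel's inequality for the columns of `N`. -/
theorem transpose_mulVec_dotProduct_self_le {ι γ : Type} [Fintype ι] [Fintype γ] [DecidableEq γ]
    {N : Matrix ι γ ℝ} (hN : Nᵀ * N = 1) (a : ι → ℝ) :
    (Nᵀ *ᵥ a) ⬝ᵥ (Nᵀ *ᵥ a) ≤ a ⬝ᵥ a := by
  have h1 : (N *ᵥ (Nᵀ *ᵥ a)) ⬝ᵥ a = (Nᵀ *ᵥ a) ⬝ᵥ (Nᵀ *ᵥ a) := by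
    rw [dotProduct_comm, dotProduct_mulVec, ← mulVec_transpose]
  have h2 : (N *ᵥ (Nᵀ *ᵥ a)) ⬝ᵥ (N *ᵥ (Nᵀ *ᵥ a)) = (Nᵀ *ᵥ a) ⬝ᵥ (Nᵀ *ᵥ a) := by
    rw [dotProduct_mulVec, ← mulVec_transpose, mulVec_mulVec, hN, one_mulVec]
  have h3 := dotProduct_self_nonneg_real (a - N *ᵥ (Nᵀ *ᵥ a))
  rw [sub_dotProduct, dotProduct_sub, dotProduct_sub, h2, dotProduct_comm a (N *ᵥ _), h1] at h3
  linarith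

theorem mulVec_dotProduct_self_of_orthonormal {ι γ : Type} [Fintype ι] [Fintype γ]
    [DecidableEq γ] {N : Matrix ι γ ℝ} (hN : Nᵀ * N = 1) (a : γ → ℝ) :
    (N *ᵥ a) ⬝ᵥ (N *ᵥ a) = a ⬝ᵥ a := by
  rw [dotProduct_mulVec, ← mulVec_transpose, mulVec_mulVec, hN, one_mulVec]

/-- A matrix with orthonormal columns on the right does not increase the Frobenius norm. -/
theorem frobenius_mul_orthonormal_le {ι κ γ : Type} [Fintype ι] [Fintype κ] [Fintype γ]
    [DecidableEq γ] (M : Matrix ι κ ℝ) {N : Matrix κ γ ℝ} (hN : Nᵀ * N = 1) :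
    ‖M * N‖ ≤ ‖M‖ := by
  refine le_of_sq_le_sq ?_ (norm_nonneg _)
  rw [frobenius_sq_rows, frobenius_sq_rows]
  refine Finset.sum_le_sum fun i _ => ?_
  have h : (M * N) i = Nᵀ *ᵥ M i := by
    ext j; simp [mul_apply, mulVec, dotProduct, mul_comm]
  rw [h]
  exact transpose_mulVec_dotProduct_self_le hN _

theorem mulVec_dotProduct_self_le {ι κ : Type} [Fintype ι] [Fintype κ] (M : Matrix ι κ ℝ)
    (a : κ → ℝ) : (M *ᵥ a) ⬝ᵥ (M *ᵥ a) ≤ ‖M‖ ^ 2 * (a ⬝ᵥ a) := by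
  rw [frobenius_sq, Finset.sum_mul]
  refine Finset.sum_le_sum fun i _ => ?_
  have := Finset.sum_mul_sq_le_sq_mul_sq Finset.univ (M i) a
  simpa [mulVec, dotProduct, sq] using this

/-! ### Singular values -/

section SingularValues

open Module

variable {E F : Type} [NormedAddCommGroup E] [InnerProductSpace ℝ E] [FiniteDimensional ℝ E]
  [NormedAddCommGroup F] [InnerProductSpace ℝ F] [FiniteDimensional ℝ F]

/-- An orthonormal basis of right singular vectors of `T`. -/
noncomputable def rightSingularBasis (T : E →ₗ[ℝ] F) : OrthonormalBasis (Fin (finrank ℝ E)) ℝ E :=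
  T.isSymmetric_adjoint_comp_self.eigenvectorBasis rfl

theorem norm_apply_sq_eq_sum (T : E →ₗ[ℝ] F) (x : E) :
    ‖T x‖ ^ 2 = ∑ i : Fin (finrank ℝ E),
      T.singularValues i ^ 2 * inner ℝ (rightSingularBasis T i) x ^ 2 := by
  have h1 : ‖T x‖ ^ 2 = inner ℝ x ((LinearMap.adjoint T ∘ₗ T) x) := by
    rw [LinearMap.comp_apply, LinearMap.adjoint_inner_right, real_inner_self_eq_norm_sq]
  rw [h1, ← (rightSingularBasis T).sum_inner_mul_inner]
  refine Finset.sum_congr rfl fun i _ => ?_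
  have h2 := T.isSymmetric_adjoint_comp_self (rightSingularBasis T i) x
  have h3 : (LinearMap.adjoint T ∘ₗ T) (rightSingularBasis T i) =
      (T.singularValues i ^ 2) • rightSingularBasis T i := by
    rw [T.sq_singularValues_fin rfl]
    exact T.isSymmetric_adjoint_comp_self.apply_eigenvectorBasis rfl i
  rw [← h2, h3, real_inner_smul_left, real_inner_comm x]
  ring

theorem norm_sq_eq_sum_inner (T : E →ₗ[ℝ] F) (x : E) :
    ‖x‖ ^ 2 = ∑ i, inner ℝ (rightSingularBasis T i) x ^ 2 := by
  rw [← (rightSingularBasis T).sum_sq_norm_inner_right]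
  simp

/-- On the orthogonal complement of its kernel, a map of rank at most `r` is bounded below by its
`r`-th singular value. -/
theorem singularValues_mul_norm_le_of_rank_le (T : E →ₗ[ℝ] F) {r : ℕ}
    (hr : finrank ℝ (LinearMap.range T) ≤ r) (x : E)
    (hx : ∀ z, T z = 0 → inner ℝ z x = 0) :
    T.singularValues (r - 1) * ‖x‖ ≤ ‖T x‖ := by
  refine le_of_sq_le_sq ?_ (norm_nonneg _)
  rw [mul_pow, norm_apply_sq_eq_sum, norm_sq_eq_sum_inner T, Finset.mul_sum]
  refine Finset.sum_le_sum fun i _ => ?_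
  by_cases hi : (i : ℕ) < finrank ℝ (LinearMap.range T)
  · gcongr
    · exact T.singularValues_nonneg _
    · exact T.singularValues_antitone (by omega)
  · have h0 : T.singularValues i = 0 :=
      T.singularValues_eq_zero_iff_le_finrank_range.2 (not_lt.1 hi)
    have hk : T (rightSingularBasis T i) = 0 := by
      rw [← norm_eq_zero, ← sq_eq_zero_iff, norm_apply_sq_eq_sum]
      refine Finset.sum_eq_zero fun j _ => ?_
      by_cases hij : j = i
      · rw [hij, h0]; simp
      · rw [(rightSingularBasis T).orthonormal.2 hij]; simp
    rw [hx _ hk]; simp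

/-- **Weyl's inequality** for singular values. -/
theorem singularValues_le_add (S T : E →ₗ[ℝ] F) {c : ℝ} (hc : ∀ x, ‖S x - T x‖ ≤ c * ‖x‖)
    {i : ℕ} (hi : i < finrank ℝ E) : S.singularValues i ≤ T.singularValues i + c := by
  -- By a dimension count, some `x ≠ 0` lies both in the span of the leading `i + 1` right
  -- singular vectors of `S` and in the span of the right singular vectors of `T` from the
  -- `i`-th on.
  let f : E →ₗ[ℝ] (Fin (finrank ℝ E) → ℝ) := LinearMap.pi fun j =>
    if (j : ℕ) < i then (innerₛₗ ℝ (rightSingularBasis T j))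
    else if i < (j : ℕ) then (innerₛₗ ℝ (rightSingularBasis S j)) else 0
  have hf : ¬ Function.Injective f := by
    intro h
    have hs : Function.Surjective f :=
      (LinearMap.injective_iff_surjective_of_finrank_eq_finrank (by simp)).1 h
    obtain ⟨x, hx⟩ := hs (Pi.single ⟨i, hi⟩ 1)
    have := congrFun hx ⟨i, hi⟩
    simp [f] at this
  rw [← LinearMap.ker_eq_bot, Submodule.eq_bot_iff] at hf
  push Not at hf
  obtain ⟨x, hx, hx0⟩ := hf
  have hxT : ∀ j : Fin (finrank ℝ E), (j : ℕ) < i → inner ℝ (rightSingularBasis T j) x = 0 := by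
    intro j hj
    have := congrFun (LinearMap.mem_ker.1 hx) j
    simpa [f, hj] using this
  have hxS : ∀ j : Fin (finrank ℝ E), i < (j : ℕ) → inner ℝ (rightSingularBasis S j) x = 0 := by
    intro j hj
    have := congrFun (LinearMap.mem_ker.1 hx) j
    simpa [f, hj, hj.le, not_lt.2 hj.le] using this
  have hT : ‖T x‖ ≤ T.singularValues i * ‖x‖ := by
    refine le_of_sq_le_sq ?_ (mul_nonneg (T.singularValues_nonneg _) (norm_nonneg _))
    rw [mul_pow, norm_apply_sq_eq_sum, norm_sq_eq_sum_inner T, Finset.mul_sum]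
    refine Finset.sum_le_sum fun j _ => ?_
    by_cases hj : (j : ℕ) < i
    · rw [hxT j hj]; simp
    · gcongr
      · exact T.singularValues_nonneg _
      · exact T.singularValues_antitone (not_lt.1 hj)
  have hS : S.singularValues i * ‖x‖ ≤ ‖S x‖ := by
    refine le_of_sq_le_sq ?_ (norm_nonneg _)
    rw [mul_pow, norm_apply_sq_eq_sum, norm_sq_eq_sum_inner S, Finset.mul_sum]
    refine Finset.sum_le_sum fun j _ => ?_
    by_cases hj : i < (j : ℕ)
    · rw [hxS j hj]; simp
    · gcongr
      · exact S.singularValues_nonneg _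
      · exact S.singularValues_antitone (not_lt.1 hj)
  have h1 : ‖S x‖ ≤ ‖T x‖ + ‖S x - T x‖ := by
    simpa using norm_add_le (T x) (S x - T x)
  refine le_of_mul_le_mul_right ?_ (norm_pos_iff.2 hx0)
  linarith [hc x]

end SingularValues

section MatrixSingularValues

variable {ι κ : Type} [Fintype ι] [Fintype κ] [DecidableEq κ]

theorem finrank_range_toEuclideanLin (M : Matrix ι κ ℝ) :
    Module.finrank ℝ (LinearMap.range (Matrix.toEuclideanLin M)) = M.rank := by
  rw [Matrix.rank_eq_finrank_range_toLin M (PiLp.basisFun 2 ℝ ι) (PiLp.basisFun 2 ℝ κ)]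
  rfl

theorem sv_nonneg (M : Matrix ι κ ℝ) (i : ℕ) : 0 ≤ sv M i :=
  LinearMap.singularValues_nonneg _ _

/-- Since `sv M 0 = sv M 1` by truncated subtraction, this also shows `0 < M.rank` when `i = 0`. -/
theorem sub_one_lt_rank_of_sv_pos {M : Matrix ι κ ℝ} {i : ℕ} (h : 0 < sv M i) :
    i - 1 < M.rank := by
  have := (LinearMap.singularValues_pos_iff_lt_finrank_range _).1 h
  rwa [finrank_range_toEuclideanLin] at this

theorem sv_antitone (M : Matrix ι κ ℝ) {i j : ℕ} (h : i ≤ j) : sv M j ≤ sv M i :=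
  LinearMap.singularValues_antitone _ (Nat.sub_le_sub_right h 1)

theorem sv_sq_mul_le_of_rank_le (M : Matrix ι κ ℝ) {r : ℕ} (hr : M.rank ≤ r) (x : κ → ℝ)
    (hx : ∀ z, M *ᵥ z = 0 → z ⬝ᵥ x = 0) :
    sv M r ^ 2 * (x ⬝ᵥ x) ≤ (M *ᵥ x) ⬝ᵥ (M *ᵥ x) := by
  have h := singularValues_mul_norm_le_of_rank_le (Matrix.toEuclideanLin M) (r := r)
    (by rwa [finrank_range_toEuclideanLin]) (WithLp.toLp 2 x) (by
      intro z hz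
      have h1 : M *ᵥ z.ofLp = 0 := by
        have := congrArg WithLp.ofLp hz
        simpa using this
      have := hx _ h1
      rw [EuclideanSpace.inner_eq_star_dotProduct]
      simpa [dotProduct_comm] using this)
  have h2 := pow_le_pow_left₀ (mul_nonneg (sv_nonneg M r) (norm_nonneg _)) h 2
  rw [mul_pow, norm_toLp_sq, toLpLin_toLp, norm_toLp_sq] at h2
  exact h2

/-- **Weyl's inequality** with the Frobenius norm of the perturbation. -/
theorem sv_le_add_frobenius (M N : Matrix ι κ ℝ) {i : ℕ} (hi : i - 1 < Fintype.card κ) :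
    sv M i ≤ sv N i + ‖M - N‖ := by
  refine singularValues_le_add _ _ (fun x => ?_) (by simpa using hi)
  refine le_of_sq_le_sq ?_ (by positivity)
  have h := mulVec_dotProduct_self_le (M - N) x.ofLp
  rw [← norm_toLp_sq, ← norm_toLp_sq] at h
  have h2 : WithLp.toLp 2 ((M - N) *ᵥ x.ofLp) =
      (Matrix.toEuclideanLin M) x - (Matrix.toEuclideanLin N) x := by
    rw [← LinearMap.sub_apply, ← map_sub]; rfl
  rw [h2] at h
  rw [mul_pow]
  exact h

/-- The kernel of a perturbed matrix `Mhat` is close to that of `M`: orthonormal columns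
annihilated by `Mhat` are approximated by their orthogonal projections to `ker M`. -/
theorem exists_mul_eq_zero_near {γ : Type} [Fintype γ] [DecidableEq γ]
    (M Mhat : Matrix ι κ ℝ) {r : ℕ} (hr : M.rank ≤ r)
    (N : Matrix κ γ ℝ) (hN : Nᵀ * N = 1) (hMN : Mhat * N = 0) :
    ∃ P : Matrix κ γ ℝ, M * P = 0 ∧ sv M r * ‖N - P‖ ≤ ‖Mhat - M‖ := by
  let K : Submodule ℝ (EuclideanSpace ℝ κ) := LinearMap.ker (Matrix.toEuclideanLin M)
  let P : Matrix κ γ ℝ := fun a j => (K.starProjection (WithLp.toLp 2 (N.col j))).ofLp a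
  have hP : M * P = 0 := by
    ext i j
    have h1 : Matrix.toEuclideanLin M (K.starProjection (WithLp.toLp 2 (N.col j))) = 0 :=
      LinearMap.mem_ker.1 (K.starProjection_apply_mem _)
    have h2 := congrFun (congrArg WithLp.ofLp h1) i
    simpa [mulVec, mul_apply, dotProduct] using h2
  refine ⟨P, hP, ?_⟩
  refine le_of_sq_le_sq ?_ (norm_nonneg _)
  have h1 : sv M r ^ 2 * ‖N - P‖ ^ 2 ≤ ‖M * (N - P)‖ ^ 2 := by
    rw [frobenius_sq_cols, frobenius_sq_cols, Finset.mul_sum]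
    refine Finset.sum_le_sum fun j _ => ?_
    refine (sv_sq_mul_le_of_rank_le M hr _ ?_).trans_eq rfl
    intro z hz
    have hz' : WithLp.toLp 2 z ∈ K := by
      simp [K, hz]
    have h3 := K.starProjection_inner_eq_zero (WithLp.toLp 2 (N.col j)) _ hz'
    rw [real_inner_comm, EuclideanSpace.inner_eq_star_dotProduct] at h3
    have h5 : (N - P).col j = (WithLp.toLp 2 (N.col j) -
        K.starProjection (WithLp.toLp 2 (N.col j))).ofLp := rfl
    rw [dotProduct_comm, h5]
    exact h3
  rw [mul_pow]
  refine h1.trans ?_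
  have h4 : M * (N - P) = (M - Mhat) * N := by
    rw [Matrix.mul_sub, hP, Matrix.sub_mul, hMN]
  rw [h4, norm_sub_rev]
  exact pow_le_pow_left₀ (norm_nonneg _) (frobenius_mul_orthonormal_le _ hN) 2

end MatrixSingularValues

/-! ### Principal vectors and angles -/

section PrincipalVectors

variable {ι : Type} [Fintype ι]

/-- The vectors of `X` that are orthogonal to `a`. -/
def orthIn (X : Submodule ℝ (ι → ℝ)) (a : ι → ℝ) : Submodule ℝ (ι → ℝ) :=
  (LinearMap.ker ((dotProductBilin ℝ ℝ a) ∘ₗ X.subtype)).map X.subtype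

theorem mem_orthIn {X : Submodule ℝ (ι → ℝ)} {a b : ι → ℝ} :
    b ∈ orthIn X a ↔ b ∈ X ∧ b ⬝ᵥ a = 0 := by
  simp only [orthIn, Submodule.mem_map, LinearMap.mem_ker, LinearMap.comp_apply,
    Submodule.subtype_apply, dotProductBilin_apply_apply, Subtype.exists, dotProduct_comm b a]
  constructor
  · rintro ⟨c, hc, h, rfl⟩
    exact ⟨hc, h⟩
  · rintro ⟨h1, h2⟩
    exact ⟨b, h1, h2, rfl⟩

theorem finrank_orthIn {X : Submodule ℝ (ι → ℝ)} {a : ι → ℝ} (ha : a ∈ X) (h1 : a ⬝ᵥ a = 1) :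
    Module.finrank ℝ (orthIn X a) + 1 = Module.finrank ℝ X := by
  rw [orthIn, Submodule.finrank_map_subtype_eq]
  have h := LinearMap.finrank_range_add_finrank_ker ((dotProductBilin ℝ ℝ a) ∘ₗ X.subtype)
  have hs : LinearMap.range ((dotProductBilin ℝ ℝ a) ∘ₗ X.subtype) = ⊤ := by
    refine LinearMap.range_eq_top.2 fun c => ⟨c • ⟨a, ha⟩, ?_⟩
    simp [h1]
  rw [hs, finrank_top, Module.finrank_self] at h
  omega

theorem exists_unit_mem {X : Submodule ℝ (ι → ℝ)} (hX : 0 < Module.finrank ℝ X) :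
    ∃ a ∈ X, a ⬝ᵥ a = 1 := by
  have : Nontrivial X := Module.nontrivial_of_finrank_pos hX
  obtain ⟨⟨a, ha⟩, h0⟩ := exists_ne (0 : X)
  have h0' : a ≠ 0 := fun h => h0 (Subtype.ext h)
  have hp : 0 < a ⬝ᵥ a :=
    lt_of_le_of_ne (dotProduct_self_nonneg_real a) fun h => h0' (dotProduct_self_eq_zero.1 h.symm)
  refine ⟨(√(a ⬝ᵥ a))⁻¹ • a, X.smul_mem _ ha, ?_⟩
  rw [smul_dotProduct, dotProduct_smul, smul_eq_mul, smul_eq_mul, ← mul_assoc, ← mul_inv,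
    Real.mul_self_sqrt hp.le, inv_mul_cancel₀ hp.ne']

theorem isCompact_unit_mem (X : Submodule ℝ (ι → ℝ)) :
    IsCompact {a : ι → ℝ | a ∈ X ∧ a ⬝ᵥ a = 1} := by
  refine Metric.isCompact_of_isClosed_isBounded ?_ ?_
  · refine IsClosed.inter X.closed_of_finiteDimensional ?_
    exact isClosed_eq (by simp only [dotProduct]; fun_prop) continuous_const
  · refine (Metric.isBounded_closedBall (x := (0 : ι → ℝ)) (r := 1)).subset ?_
    rintro a ⟨-, ha⟩
    rw [mem_closedBall_zero_iff, pi_norm_le_iff_of_nonneg zero_le_one]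
    intro i
    rw [Real.norm_eq_abs, ← sq_le_one_iff_abs_le_one, ← ha, pow_two]
    exact Finset.single_le_sum (f := fun i => a i * a i) (fun _ _ => mul_self_nonneg _)
      (Finset.mem_univ i)

/-- Principal vectors exist: they are chosen greedily, by compactness of the unit spheres. -/
theorem exists_isPrincipalVectors (k : ℕ) (X Y : Submodule ℝ (ι → ℝ))
    (hX : Module.finrank ℝ X = k) (hY : Module.finrank ℝ Y = k) :
    ∃ x y : Fin k → ι → ℝ, IsPrincipalVectors X Y x y := by
  induction k generalizing X Y with
  | zero =>
    exact ⟨Fin.elim0, Fin.elim0, hX, hY, fun i => i.elim0, fun i => i.elim0, fun i => i.elim0,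
      fun i => i.elim0, fun i => i.elim0, fun i => i.elim0, fun i => i.elim0⟩
  | succ k ih =>
    obtain ⟨a₀, ha₀⟩ := exists_unit_mem (X := X) (by omega)
    obtain ⟨b₀, hb₀⟩ := exists_unit_mem (X := Y) (by omega)
    obtain ⟨⟨a, b⟩, ⟨⟨haX, ha1⟩, ⟨hbY, hb1⟩⟩, hmax⟩ :=
      ((isCompact_unit_mem X).prod (isCompact_unit_mem Y)).exists_isMaxOn
        ⟨(a₀, b₀), ha₀, hb₀⟩ (f := fun z => z.1 ⬝ᵥ z.2)
        (by simp only [dotProduct]; fun_prop)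
    dsimp only at haX ha1 hbY hb1
    have hX' := finrank_orthIn haX ha1
    have hY' := finrank_orthIn hbY hb1
    obtain ⟨x, y, h⟩ := ih (orthIn X a) (orthIn Y b) (by omega) (by omega)
    refine ⟨Fin.cons a x, Fin.cons b y, hX, hY, ?_, ?_, ?_, ?_, ?_, ?_, ?_⟩
    · refine Fin.cases haX fun i => (mem_orthIn.1 (h.mem_left i)).1
    · refine Fin.cases hbY fun i => (mem_orthIn.1 (h.mem_right i)).1
    · refine Fin.cases ha1 fun i => h.unit_left i
    · refine Fin.cases hb1 fun i => h.unit_right i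
    · refine Fin.cases (fun j hj => absurd hj (Fin.not_lt_zero j)) fun i => ?_
      refine Fin.cases (fun _ => (mem_orthIn.1 (h.mem_left i)).2) fun j hj => ?_
      exact h.orth_left i j (Fin.succ_lt_succ_iff.1 hj)
    · refine Fin.cases (fun j hj => absurd hj (Fin.not_lt_zero j)) fun i => ?_
      refine Fin.cases (fun _ => (mem_orthIn.1 (h.mem_right i)).2) fun j hj => ?_
      exact h.orth_right i j (Fin.succ_lt_succ_iff.1 hj)
    · refine Fin.cases (fun a' ha' b' hb' h1 h2 _ _ =>
        hmax (show (a', b') ∈ _ from ⟨⟨ha', h1⟩, hb', h2⟩)) fun i => ?_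
      intro a' ha' b' hb' h1 h2 h3 h4
      exact h.maximal i a' (mem_orthIn.2 ⟨ha', h3 0 (Fin.succ_pos i)⟩) b'
        (mem_orthIn.2 ⟨hb', h4 0 (Fin.succ_pos i)⟩) h1 h2
        (fun j hj => h3 j.succ (Fin.succ_lt_succ_iff.2 hj))
        (fun j hj => h4 j.succ (Fin.succ_lt_succ_iff.2 hj))

/-- First-order optimality: if the unit vector `b` maximizes `a ⬝ᵥ ·` among the unit vectors in
the span of `b` and `c`, then `a` is orthogonal to `c`. -/
theorem dotProduct_eq_zero_of_maximal {a b c : ι → ℝ} (hb : b ⬝ᵥ b = 1) (hc : c ⬝ᵥ c = 1)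
    (hbc : b ⬝ᵥ c = 0)
    (hmax : ∀ s t : ℝ, (s • b + t • c) ⬝ᵥ (s • b + t • c) = 1 →
      a ⬝ᵥ (s • b + t • c) ≤ a ⬝ᵥ b) : a ⬝ᵥ c = 0 := by
  -- Test with the normalization of `(a ⬝ᵥ b) • b + (a ⬝ᵥ c) • c`.
  by_contra h
  set α := a ⬝ᵥ b
  set β := a ⬝ᵥ c
  have hβ : 0 < β ^ 2 := by positivity
  set ν := √(α ^ 2 + β ^ 2)
  have hν2 : ν ^ 2 = α ^ 2 + β ^ 2 := Real.sq_sqrt (by positivity)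
  have hν : 0 < ν := Real.sqrt_pos.2 (by positivity)
  have h1 := hmax (α / ν) (β / ν) (by
    simp only [add_dotProduct, dotProduct_add, smul_dotProduct, dotProduct_smul, hb, hc, hbc,
      dotProduct_comm c b, smul_eq_mul]
    field_simp
    linarith)
  have h2 : a ⬝ᵥ ((α / ν) • b + (β / ν) • c) = ν := by
    simp only [dotProduct_add, dotProduct_smul, smul_eq_mul]
    change α / ν * α + β / ν * β = ν
    field_simp
    linarith
  rw [h2] at h1
  nlinarith

namespace IsPrincipalVectors

variable {k : ℕ} {X Y : Submodule ℝ (ι → ℝ)} {x y : Fin k → ι → ℝ}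

theorem symm (h : IsPrincipalVectors X Y x y) : IsPrincipalVectors Y X y x where
  finrank_left := h.finrank_right
  finrank_right := h.finrank_left
  mem_left := h.mem_right
  mem_right := h.mem_left
  unit_left := h.unit_right
  unit_right := h.unit_left
  orth_left := h.orth_right
  orth_right := h.orth_left
  maximal i a ha b hb h1 h2 h3 h4 := by
    rw [dotProduct_comm a b, dotProduct_comm (y i)]
    exact h.maximal i b hb a ha h2 h1 h4 h3

theorem left_orthogonal (h : IsPrincipalVectors X Y x y) {i j : Fin k} (hij : i ≠ j) :
    x i ⬝ᵥ x j = 0 := by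
  rcases lt_or_gt_of_ne hij with h1 | h1
  · rw [dotProduct_comm]; exact h.orth_left j i h1
  · exact h.orth_left i j h1

theorem dotProduct_of_lt (h : IsPrincipalVectors X Y x y) {i j : Fin k} (hij : i < j) :
    x i ⬝ᵥ y j = 0 := by
  refine dotProduct_eq_zero_of_maximal (h.unit_right i) (h.unit_right j)
    (h.symm.left_orthogonal hij.ne) fun s t hst => ?_
  refine h.maximal i _ (h.mem_left i) _
    (Y.add_mem (Y.smul_mem _ (h.mem_right i)) (Y.smul_mem _ (h.mem_right j)))
    (h.unit_left i) hst (fun l hl => h.orth_left i l hl) fun l hl => ?_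
  rw [add_dotProduct, smul_dotProduct, smul_dotProduct, h.orth_right i l hl,
    h.orth_right j l (hl.trans hij)]
  simp

theorem dotProduct_of_ne (h : IsPrincipalVectors X Y x y) {i j : Fin k} (hij : i ≠ j) :
    x i ⬝ᵥ y j = 0 := by
  rcases lt_or_gt_of_ne hij with h1 | h1
  · exact h.dotProduct_of_lt h1
  · rw [dotProduct_comm]; exact h.symm.dotProduct_of_lt h1

theorem dotProduct_nonneg (h : IsPrincipalVectors X Y x y) (i : Fin k) : 0 ≤ x i ⬝ᵥ y i := by
  have h1 := h.maximal i (x i) (h.mem_left i) (-y i) (Y.neg_mem (h.mem_right i)) (h.unit_left i)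
    (by rw [neg_dotProduct_neg]; exact h.unit_right i) (fun j hj => h.orth_left i j hj)
    (fun j hj => by rw [neg_dotProduct, h.orth_right i j hj, neg_zero])
  rw [dotProduct_neg] at h1
  linarith

theorem dotProduct_le_one (h : IsPrincipalVectors X Y x y) (i : Fin k) :
    x i ⬝ᵥ y i ≤ 1 := by
  have h1 := dotProduct_self_nonneg_real (x i - y i)
  rw [sub_dotProduct, dotProduct_sub, dotProduct_sub, h.unit_left, h.unit_right,
    dotProduct_comm (y i)] at h1
  linarith

theorem sq_sin_arccos (h : IsPrincipalVectors X Y x y) (i : Fin k) :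
    Real.sin (Real.arccos (x i ⬝ᵥ y i)) ^ 2 = 1 - (x i ⬝ᵥ y i) ^ 2 := by
  have h0 := h.dotProduct_nonneg i
  have h1 := h.dotProduct_le_one i
  rw [Real.sin_arccos, Real.sq_sqrt]
  nlinarith

theorem mul_transpose_left (h : IsPrincipalVectors X Y x y) : of x * (of x)ᵀ = 1 := by
  ext i j
  have h1 : (of x * (of x)ᵀ) i j = x i ⬝ᵥ x j := by simp [mul_apply, dotProduct]
  rw [h1, one_apply]
  split_ifs with hij
  · rw [hij]; exact h.unit_left j
  · exact h.left_orthogonal hij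

/-- Principal vectors of `X` form an orthonormal basis of `X`. -/
theorem expansion (h : IsPrincipalVectors X Y x y) {a : ι → ℝ} (ha : a ∈ X) :
    (of x)ᵀ *ᵥ (of x *ᵥ a) = a := by
  have hli : Function.Injective (of x)ᵀ.mulVecLin := by
    intro u v huv
    have := congrArg (fun z => of x *ᵥ z) huv
    simpa only [mulVecLin_apply, mulVec_mulVec, h.mul_transpose_left, one_mulVec] using this
  have hle : LinearMap.range (of x)ᵀ.mulVecLin ≤ X := by
    rintro _ ⟨c, rfl⟩
    rw [mulVecLin_apply, mulVec_eq_sum]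
    exact X.sum_mem fun i _ => by
      rw [op_smul_eq_smul]
      exact X.smul_mem _ (h.mem_left i)
  have heq := Submodule.eq_of_le_of_finrank_eq hle (by
    rw [LinearMap.finrank_range_of_inj hli, h.finrank_left]; simp)
  rw [← heq] at ha
  obtain ⟨c, rfl⟩ := ha
  rw [mulVecLin_apply, mulVec_mulVec _ (of x), h.mul_transpose_left, one_mulVec]

end IsPrincipalVectors

/-- The squared sines of the principal angles in terms of the principal vectors. -/
theorem norm_sin_sq {k : ℕ} {X Y : Submodule ℝ (ι → ℝ)} {x y : Fin k → ι → ℝ}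
    (h : IsPrincipalVectors X Y x y) {θ : Fin k → ℝ}
    (hθ : ∀ i, θ i = Real.arccos (x i ⬝ᵥ y i)) :
    ‖diagonal (fun i => Real.sin (θ i))‖ ^ 2 = ∑ i, (1 - (x i ⬝ᵥ y i) ^ 2) := by
  rw [frobenius_norm_diagonal, norm_toLp_sq]
  refine Finset.sum_congr rfl fun i _ => ?_
  rw [← h.sq_sin_arccos, ← hθ i, pow_two]

variable {κ : Type} [Fintype κ]

theorem finrank_ker_transpose (H : Matrix ι κ ℝ) :
    Module.finrank ℝ (LinearMap.ker Hᵀ.mulVecLin) + H.rank = Fintype.card ι := by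
  have h := LinearMap.finrank_range_add_finrank_ker Hᵀ.mulVecLin
  have h2 : Module.finrank ℝ (LinearMap.range Hᵀ.mulVecLin) = H.rank := by
    rw [← rank_transpose]; rfl
  rw [h2, Module.finrank_fintype_fun_eq_card] at h
  omega

omit [Fintype ι] in
theorem IsNull.finrank_ker {γ : Type} [Fintype γ] [DecidableEq γ] {N : Matrix κ γ ℝ}
    {M : Matrix ι κ ℝ} (h : IsNull N M) :
    Module.finrank ℝ (LinearMap.ker M.mulVecLin) = Fintype.card γ := by
  rw [← h.2, LinearMap.finrank_range_of_inj, Module.finrank_fintype_fun_eq_card]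
  intro u v huv
  have := congrArg (fun z => Nᵀ *ᵥ z) huv
  simpa [mulVec_mulVec, h.1] using this

omit [Fintype ι] in
theorem IsNull.mul_eq_zero {γ : Type} [Fintype γ] [DecidableEq γ] {N : Matrix κ γ ℝ}
    {M : Matrix ι κ ℝ} (h : IsNull N M) : M * N = 0 := by
  refine ext_of_mulVec_single fun i => ?_
  rw [← mulVec_mulVec, zero_mulVec]
  have : N.mulVecLin (Pi.single i 1) ∈ LinearMap.ker M.mulVecLin := h.2 ▸ ⟨_, rfl⟩
  exact this

/-- The orthonormal basis of `ker Hᵀ` that is matched to `Rhat` carries the coordinates of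
`Rhat` with respect to the principal vectors of `ker Hhatᵀ` over to those of `ker Hᵀ`
(an orthogonal Procrustes solution). -/
theorem exists_isMatchedLeftNull {g r : ℕ} {Hhat H : Matrix ι κ ℝ} {Rhat : Matrix (Fin g) ι ℝ}
    (hR : IsNull Rhatᵀ Hhatᵀ) (hH : H.rank = r) (hg : g + r = Fintype.card ι) :
    ∃ R : Matrix (Fin g) ι ℝ, IsMatchedLeftNull r Hhat H Rhat R := by
  have hX : Module.finrank ℝ (LinearMap.ker Hhatᵀ.mulVecLin) = g := by
    simpa using hR.finrank_ker
  have hY : Module.finrank ℝ (LinearMap.ker Hᵀ.mulVecLin) = g := by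
    have := finrank_ker_transpose H
    omega
  obtain ⟨x, y, h⟩ := exists_isPrincipalVectors g _ _ hX hY
  have hang : IsPrincipalAngles (LinearMap.ker Hhatᵀ.mulVecLin) (LinearMap.ker Hᵀ.mulVecLin)
      (fun i => Real.arccos (x i ⬝ᵥ y i)) := ⟨x, y, h, fun _ => rfl⟩
  rcases Nat.eq_zero_or_pos r with rfl | hr
  · -- Both left null spaces are the whole space.
    have e1 : LinearMap.ker Hhatᵀ.mulVecLin = ⊤ :=
      Submodule.eq_top_of_finrank_eq (by rw [hX]; simpa using hg)
    have e2 : LinearMap.ker Hᵀ.mulVecLin = ⊤ :=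
      Submodule.eq_top_of_finrank_eq (by rw [hY]; simpa using hg)
    refine ⟨Rhat, ⟨hR.1, by rw [hR.2, e1, e2]⟩, _, hang, by simp⟩
  have hRR : Rhat * Rhatᵀ = 1 := by simpa using hR.1
  set Q : Matrix (Fin g) (Fin g) ℝ := Rhat * (of x)ᵀ with hQ
  have hQx : Q * of x = Rhat := by
    have h1 : (Q * of x)ᵀ = Rhatᵀ := by
      refine ext_of_mulVec_single fun i => ?_
      have hmem : Rhatᵀ *ᵥ Pi.single i 1 ∈ LinearMap.ker Hhatᵀ.mulVecLin := hR.2 ▸ ⟨_, rfl⟩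
      rw [hQ, transpose_mul, transpose_mul, transpose_transpose, ← mulVec_mulVec, ← mulVec_mulVec,
        h.expansion hmem]
    simpa using congrArg transpose h1
  have hQQ : Q * Qᵀ = 1 := by
    calc Q * Qᵀ = (Q * of x) * Rhatᵀ := by
          rw [hQ, transpose_mul, transpose_transpose]; simp only [Matrix.mul_assoc]
      _ = 1 := by rw [hQx, hRR]
  have hQQ' : Qᵀ * Q = 1 := mul_eq_one_comm.1 hQQ
  refine ⟨Q * of y, ⟨?_, ?_⟩, _, hang, ?_⟩
  · rw [transpose_transpose, transpose_mul, Matrix.mul_assoc, ← Matrix.mul_assoc (of y),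
      h.symm.mul_transpose_left, Matrix.one_mul, hQQ]
  · ext z
    rw [transpose_mul]
    constructor
    · rintro ⟨c, rfl⟩
      rw [mulVecLin_apply, ← mulVec_mulVec, mulVec_eq_sum]
      exact Submodule.sum_mem _ fun i _ => by
        rw [op_smul_eq_smul]
        exact Submodule.smul_mem _ _ (h.mem_right i)
    · intro hz
      refine ⟨Q *ᵥ (of y *ᵥ z), ?_⟩
      rw [mulVecLin_apply, ← mulVec_mulVec, mulVec_mulVec _ Qᵀ, hQQ', one_mulVec,
        h.symm.expansion hz]
  · refine le_of_sq_le_sq ?_ (by positivity)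
    have h1 : ‖Rhat - Q * of y‖ ≤ ‖of x - of y‖ := by
      have e : Rhat - Q * of y = Q * (of x - of y) := by rw [Matrix.mul_sub, hQx]
      rw [e, ← frobenius_norm_transpose, transpose_mul, ← frobenius_norm_transpose (of x - of y)]
      exact frobenius_mul_orthonormal_le _ (by rw [transpose_transpose, hQQ])
    have h2 : ‖of x - of y‖ ^ 2 ≤ 2 * ∑ i, (1 - (x i ⬝ᵥ y i) ^ 2) := by
      rw [frobenius_sq_rows, Finset.mul_sum]
      refine Finset.sum_le_sum fun i _ => ?_
      have h3 : (of x - of y) i = x i - y i := rfl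
      rw [h3, sub_dotProduct, dotProduct_sub, dotProduct_sub, h.unit_left, h.unit_right,
        dotProduct_comm (y i)]
      nlinarith [h.dotProduct_nonneg i, h.dotProduct_le_one i]
    have h4 := norm_sin_sq h (θ := fun i => Real.arccos (x i ⬝ᵥ y i)) fun _ => rfl
    rw [mul_pow, mul_pow, Real.sq_sqrt (Nat.cast_nonneg _), h4]
    have hr' : (1 : ℝ) ≤ r := by exact_mod_cast hr
    have h5 : 0 ≤ ∑ i, (1 - (x i ⬝ᵥ y i) ^ 2) := by rw [← h4]; positivity
    nlinarith [pow_le_pow_left₀ (norm_nonneg _) h1 2]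

end PrincipalVectors

/-! ### Perturbation of the left null space -/

section Wedin

variable {ι κ : Type} [Fintype ι] [Fintype κ] [DecidableEq κ]

/-- **Wedin's theorem** for the left null spaces of a matrix `H` of rank `r` and of a rank-`r`
truncated singular value decomposition of a perturbation `M` of `H`. -/
theorem norm_sin_le_of_isTSVD {g r : ℕ} {H M Mhat : Matrix ι κ ℝ} (hM : IsTSVD r M Mhat)
    (hr : 0 < r) (hH : H.rank = r) (hgap : ‖M - H‖ < sv H r) {θ : Fin g → ℝ}
    (hθ : IsPrincipalAngles (LinearMap.ker Mhatᵀ.mulVecLin) (LinearMap.ker Hᵀ.mulVecLin) θ) :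
    (sv H r - ‖M - H‖) * ‖diagonal (fun i => Real.sin (θ i))‖ ≤ ‖M - H‖ := by
  have hweyl : sv H r ≤ sv M r + ‖M - H‖ := by
    rw [norm_sub_rev]
    refine sv_le_add_frobenius H M ?_
    have := H.rank_le_card_width
    omega
  have hs : 0 < sv M r := by linarith
  have hsi : ∀ i : Fin r, sv M r ≤ sv M (i + 1) := fun i => sv_antitone M i.isLt
  obtain ⟨k, U, W, V, Q, hUW, hVQ, hMeq, hMhat⟩ := hM
  have hU : Uᵀ * U = 1 := by
    rw [transpose_fromCols, fromRows_mul_fromCols, ← fromBlocks_one, fromBlocks_inj] at hUW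
    exact hUW.1
  have hV : Vᵀ * V = 1 := by
    rw [transpose_fromCols, fromRows_mul_fromCols, ← fromBlocks_one, fromBlocks_inj] at hVQ
    exact hVQ.1
  -- The left null space of the truncated matrix is the orthogonal complement of the leading left
  -- singular vectors.
  have hker : ∀ a : ι → ℝ, Mhatᵀ *ᵥ a = 0 ↔ Uᵀ *ᵥ a = 0 := by
    intro a
    have e : Mhatᵀ *ᵥ a = V *ᵥ (diagonal (fun i : Fin r => sv M (i + 1)) *ᵥ (Uᵀ *ᵥ a)) := by
      rw [hMhat, transpose_mul, transpose_mul, transpose_transpose, diagonal_transpose,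
        mulVec_mulVec, mulVec_mulVec]
      simp only [Matrix.mul_assoc]
    rw [e]
    refine ⟨fun h => ?_, fun h => by rw [h, mulVec_zero, mulVec_zero]⟩
    have h1 := congrArg (fun z => Vᵀ *ᵥ z) h
    simp only [mulVec_zero] at h1
    rw [mulVec_mulVec, hV, one_mulVec] at h1
    ext i
    have h2 := congrFun h1 i
    rw [mulVec_diagonal] at h2
    exact (mul_eq_zero.1 h2).resolve_left (hs.trans_le (hsi i)).ne'
  -- `Mᵀ` is bounded below by the `r`-th singular value on the leading left singular vectors.
  have hlow : ∀ a : ι → ℝ,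
      sv M r ^ 2 * ((Uᵀ *ᵥ a) ⬝ᵥ (Uᵀ *ᵥ a)) ≤ (Mᵀ *ᵥ a) ⬝ᵥ (Mᵀ *ᵥ a) := by
    intro a
    set D := Sum.elim (fun i : Fin r => sv M (i + 1)) (fun j : Fin k => sv M (r + j + 1)) with hD
    have e : Mᵀ *ᵥ a = fromCols V Q *ᵥ (diagonal D *ᵥ ((fromCols U W)ᵀ *ᵥ a)) := by
      conv_lhs => rw [hMeq, transpose_mul, transpose_mul, transpose_transpose, diagonal_transpose]
      rw [mulVec_mulVec, mulVec_mulVec]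
      simp only [Matrix.mul_assoc]
    have hUa : ∀ i, ((fromCols U W)ᵀ *ᵥ a) (Sum.inl i) = (Uᵀ *ᵥ a) i := fun _ => rfl
    rw [e, mulVec_dotProduct_self_of_orthonormal hVQ, dotProduct, dotProduct, Fintype.sum_sum_type,
      Finset.mul_sum]
    refine le_add_of_le_of_nonneg (Finset.sum_le_sum fun i _ => ?_)
      (Finset.sum_nonneg fun _ _ => mul_self_nonneg _)
    rw [mulVec_diagonal, hUa]
    have h1 : D (Sum.inl i) = sv M (i + 1) := rfl
    rw [h1, ← pow_two, ← pow_two, mul_pow]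
    exact mul_le_mul_of_nonneg_right (pow_le_pow_left₀ hs.le (hsi i) 2) (sq_nonneg _)
  obtain ⟨x, y, h, hxy⟩ := hθ
  have hsin : ∀ i, 1 - (x i ⬝ᵥ y i) ^ 2 = (Uᵀ *ᵥ y i) ⬝ᵥ (Uᵀ *ᵥ y i) := by
    intro i
    have hUx : Uᵀ *ᵥ x i = 0 := (hker _).1 (h.mem_left i)
    have hz : y i - U *ᵥ (Uᵀ *ᵥ y i) ∈ LinearMap.ker Mhatᵀ.mulVecLin := by
      refine (hker _).2 ?_
      rw [mulVec_sub, mulVec_mulVec _ Uᵀ U, hU, one_mulVec, sub_self]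
    -- The projection of `y i` to the left null space of the truncated matrix is
    -- `(x i ⬝ᵥ y i) • x i`.
    have hproj : y i - U *ᵥ (Uᵀ *ᵥ y i) = (x i ⬝ᵥ y i) • x i := by
      rw [← h.expansion hz]
      have hc : of x *ᵥ (y i - U *ᵥ (Uᵀ *ᵥ y i)) = Pi.single i (x i ⬝ᵥ y i) := by
        ext j
        have h0 : Uᵀ *ᵥ x j = 0 := (hker _).1 (h.mem_left j)
        change x j ⬝ᵥ (y i - U *ᵥ (Uᵀ *ᵥ y i)) = _
        rw [dotProduct_sub, dotProduct_mulVec, ← mulVec_transpose, h0, zero_dotProduct, sub_zero]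
        by_cases hij : j = i
        · rw [hij, Pi.single_eq_same]
        · rw [Pi.single_eq_of_ne hij, h.dotProduct_of_ne hij]
      rw [hc]
      ext a
      simp [mul_comm]
    have h1 : y i = (x i ⬝ᵥ y i) • x i + U *ᵥ (Uᵀ *ᵥ y i) := by rw [← hproj]; simp
    have h2 : y i ⬝ᵥ y i = (x i ⬝ᵥ y i) ^ 2 + (Uᵀ *ᵥ y i) ⬝ᵥ (Uᵀ *ᵥ y i) := by
      conv_lhs => rw [h1, add_dotProduct, ← h1]
      rw [smul_dotProduct, smul_eq_mul, ← pow_two, dotProduct_comm (U *ᵥ _), dotProduct_mulVec,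
        ← mulVec_transpose]
    rw [h.unit_right] at h2
    linarith
  have hEy : ∑ i, (Mᵀ *ᵥ y i) ⬝ᵥ (Mᵀ *ᵥ y i) ≤ ‖M - H‖ ^ 2 := by
    have e : ∀ i, Mᵀ *ᵥ y i = ((M - H)ᵀ * (of y)ᵀ).col i := by
      intro i
      have h0 : Hᵀ *ᵥ y i = 0 := h.mem_right i
      rw [show Mᵀ *ᵥ y i = (M - H)ᵀ *ᵥ y i by rw [transpose_sub, sub_mulVec, h0, sub_zero]]
      rfl
    simp only [e]
    rw [← frobenius_sq_cols, ← frobenius_norm_transpose (M - H)]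
    exact pow_le_pow_left₀ (norm_nonneg _)
      (frobenius_mul_orthonormal_le _ (by rw [transpose_transpose, h.symm.mul_transpose_left])) 2
  have hfin : sv M r * ‖diagonal (fun i => Real.sin (θ i))‖ ≤ ‖M - H‖ := by
    refine le_of_sq_le_sq ?_ (norm_nonneg _)
    rw [mul_pow, norm_sin_sq h hxy, Finset.mul_sum]
    refine (Finset.sum_le_sum fun i _ => ?_).trans hEy
    rw [hsin]
    exact hlow _
  refine le_trans ?_ hfin
  exact mul_le_mul_of_nonneg_right (by linarith) (norm_nonneg _)

end Wedin

/-! ### The matrix `Γ` -/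

section Gamma

variable {m p g d M : ℕ}

/-- Reindexing a sum over the block columns in which a shifted row is supported. -/
theorem sum_dite_shift {s : ℕ} (hs : s + d ≤ M) (f : Fin d → Fin M → ℝ) :
    (∑ a : Fin M, if h : s ≤ (a : ℕ) ∧ (a : ℕ) - s < d then f ⟨a - s, h.2⟩ a else 0) =
      ∑ b : Fin d, f b ⟨s + b, by omega⟩ := by
  symm
  refine Finset.sum_of_injOn (fun b : Fin d => (⟨s + b, by omega⟩ : Fin M)) ?_ ?_ ?_ ?_
  · intro a _ b _ hab
    simp only [Fin.mk.injEq] at hab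
    exact Fin.ext (by omega)
  · intro a _; simp
  · intro a _ ha
    rw [dif_neg]
    intro h
    refine ha ⟨⟨a - s, h.2⟩, by simp, Fin.ext ?_⟩
    simp only
    omega
  · intro b _
    have h : s ≤ s + (b : ℕ) ∧ s + (b : ℕ) - s < d := by omega
    rw [dif_pos h]
    congr 1
    exact Fin.ext (by simp)

theorem shiftedRow_dotProduct {s : ℕ} (hs : s + d ≤ M)
    (R : Matrix (Fin g) (Fin d × Sig m p) ℝ) (i : Fin g) (v : Fin M × Sig m p → ℝ) :
    shiftedRow M R s i ⬝ᵥ v = R i ⬝ᵥ fun b => v (⟨s + b.1, by omega⟩, b.2) := by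
  simp only [dotProduct]
  rw [Fintype.sum_prod_type, Fintype.sum_prod_type]
  have h := sum_dite_shift hs (fun b a => ∑ j, R i (b, j) * v (a, j))
  rw [← h]
  refine Finset.sum_congr rfl fun a _ => ?_
  simp only [shiftedRow]
  split_ifs <;> simp

theorem shiftedRow_dotProduct_self {s : ℕ} (hs : s + d ≤ M)
    (R : Matrix (Fin g) (Fin d × Sig m p) ℝ) (i : Fin g) :
    shiftedRow M R s i ⬝ᵥ shiftedRow M R s i = R i ⬝ᵥ R i := by
  rw [shiftedRow_dotProduct hs]
  congr 1
  ext b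
  have h : s ≤ s + (b.1 : ℕ) ∧ s + (b.1 : ℕ) - s < d := by have := b.1.isLt; omega
  rw [shiftedRow, dif_pos h]
  congr 2
  exact Fin.ext (by simp)

theorem gammaMat_sub (R S : Matrix (Fin g) (Fin d × Sig m p) ℝ) :
    gammaMat M R - gammaMat M S = gammaMat M (R - S) := by
  ext a b
  rcases a with i | ⟨s, i⟩ <;> rw [Matrix.sub_apply] <;>
    simp only [gammaMat, shiftedRow] <;> split_ifs <;> simp

theorem norm_gammaMat_sq_le (hd : d ≤ M) (R : Matrix (Fin g) (Fin d × Sig m p) ℝ) :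
    ‖gammaMat M R‖ ^ 2 ≤ ((M : ℝ) - d + 1) * ‖R‖ ^ 2 := by
  have h1 : ∀ s : Fin (M - d),
      ∑ i : {i : Fin g // (i : ℕ) < p}, R i ⬝ᵥ R i ≤ ∑ i, R i ⬝ᵥ R i := by
    intro _
    rw [← Fintype.sum_subtype_add_sum_subtype (fun i : Fin g => (i : ℕ) < p)]
    exact le_add_of_nonneg_right (Finset.sum_nonneg fun _ _ => dotProduct_self_nonneg_real _)
  rw [frobenius_sq_rows, frobenius_sq_rows, Fintype.sum_sum_type, Fintype.sum_prod_type]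
  have e1 : ∀ i, gammaMat M R (Sum.inl i) ⬝ᵥ gammaMat M R (Sum.inl i) = R i ⬝ᵥ R i :=
    fun i => shiftedRow_dotProduct_self (by omega) R i
  have e2 : ∀ s i, gammaMat M R (Sum.inr (s, i)) ⬝ᵥ gammaMat M R (Sum.inr (s, i)) =
      R i ⬝ᵥ R i := fun s i => shiftedRow_dotProduct_self (by omega) R i
  simp only [e1, e2]
  have h2 := Finset.sum_le_sum fun s (_ : s ∈ Finset.univ) => h1 s
  rw [Finset.sum_const (∑ i, R i ⬝ᵥ R i), Finset.card_univ, Fintype.card_fin, nsmul_eq_mul,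
    Nat.cast_sub hd] at h2
  linarith

theorem card_gammaMat_rows_le :
    Fintype.card (Fin g ⊕ (Fin (M - d) × {i : Fin g // (i : ℕ) < p})) ≤ g + (M - d) * p := by
  rw [Fintype.card_sum, Fintype.card_prod, Fintype.card_fin, Fintype.card_fin]
  have : Fintype.card {i : Fin g // (i : ℕ) < p} ≤ Fintype.card (Fin p) :=
    Fintype.card_le_of_injective (fun i => ⟨i.1, i.2⟩) fun i j hij => by
      have := congrArg Fin.val hij
      exact Subtype.ext (Fin.ext this)
  rw [Fintype.card_fin] at this
  gcongr

end Gamma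

/-! ### Windows of a state-space system -/

section Behavior

variable {m p N : ℕ} (A : Matrix (Fin N) (Fin N) ℝ) (B : Matrix (Fin N) (Fin m) ℝ)
    (C : Matrix (Fin p) (Fin N) ℝ) (D : Matrix (Fin p) (Fin m) ℝ)

/-- The state at time `k`, as a linear function of the initial state and the input signal. -/
def stateMap : ℕ → ((Fin N → ℝ) × (ℕ → Fin m → ℝ)) →ₗ[ℝ] (Fin N → ℝ)
  | 0 => LinearMap.fst ℝ _ _
  | k + 1 => A.mulVecLin ∘ₗ stateMap k +
      B.mulVecLin ∘ₗ LinearMap.proj k ∘ₗ LinearMap.snd ℝ _ _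

/-- The trajectory `(u, y)` generated by an initial state and an input signal. -/
def trajMap : ((Fin N → ℝ) × (ℕ → Fin m → ℝ)) →ₗ[ℝ] (ℕ → Sig m p → ℝ) where
  toFun z k := Sum.elim (z.2 k) (C *ᵥ stateMap A B k z + D *ᵥ z.2 k)
  map_add' z z' := by
    ext k (v | v)
    · rfl
    · simp [mulVec_add]; ring
  map_smul' c z := by
    ext k (v | v)
    · rfl
    · simp [mulVec_smul]; ring

/-- The extension of an input window by zero. -/
def extendInput (T : ℕ) : (Fin T → Fin m → ℝ) →ₗ[ℝ] (ℕ → Fin m → ℝ) where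
  toFun u k := if h : k < T then u ⟨k, h⟩ else 0
  map_add' u u' := by ext k; simp only [Pi.add_apply]; split_ifs <;> simp
  map_smul' c u := by ext k; simp only [Pi.smul_apply, RingHom.id_apply]; split_ifs <;> simp

/-- The stacked window of length `T` generated by an initial state and an input window. -/
def windowMap (T : ℕ) :
    ((Fin N → ℝ) × (Fin T → Fin m → ℝ)) →ₗ[ℝ] (Fin T × Sig m p → ℝ) where
  toFun z a := trajMap A B C D (z.1, extendInput T z.2) a.1 a.2
  map_add' z z' := by
    have h : (((z + z').1, extendInput T (z + z').2) : (Fin N → ℝ) × (ℕ → Fin m → ℝ)) =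
      (z.1, extendInput T z.2) + (z'.1, extendInput T z'.2) := by simp
    ext a; rw [h, map_add]; rfl
  map_smul' c z := by
    have h : (((c • z).1, extendInput T (c • z).2) : (Fin N → ℝ) × (ℕ → Fin m → ℝ)) =
      c • (z.1, extendInput T z.2) := by simp
    ext a; rw [h, map_smul]; rfl

theorem range_trajMap : Set.range (trajMap A B C D) = ssBehavior A B C D := by
  ext w
  constructor
  · rintro ⟨z, rfl⟩
    exact ⟨fun k => stateMap A B k z, fun k => ⟨rfl, rfl⟩⟩
  · rintro ⟨x, hx⟩
    set z : (Fin N → ℝ) × (ℕ → Fin m → ℝ) := (x 0, fun k i => w k (Sum.inl i)) with hz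
    have hs : ∀ k, stateMap A B k z = x k := by
      intro k
      induction k with
      | zero => rfl
      | succ k ih =>
        rw [(hx k).1, ← ih]; rfl
    refine ⟨z, ?_⟩
    ext k (v | v)
    · rfl
    · change (C *ᵥ stateMap A B k z + D *ᵥ z.2 k) v = _
      rw [hs]
      exact (congrFun (hx k).2 v).symm

/-- Causality: the state at time `k ≤ T` depends only on the inputs before time `T`. -/
theorem stateMap_congr {T : ℕ} {x : Fin N → ℝ} {u u' : ℕ → Fin m → ℝ}
    (h : ∀ k < T, u k = u' k) : ∀ k ≤ T, stateMap A B k (x, u) = stateMap A B k (x, u') := by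
  intro k
  induction k with
  | zero => intro _; rfl
  | succ k ih =>
    intro hk
    change A *ᵥ stateMap A B k (x, u) + B *ᵥ u k = A *ᵥ stateMap A B k (x, u') + B *ᵥ u' k
    rw [ih (by omega), h k (by omega)]

theorem trajMap_congr {T : ℕ} {x : Fin N → ℝ} {u u' : ℕ → Fin m → ℝ}
    (h : ∀ k < T, u k = u' k) {k : ℕ} (hk : k < T) :
    trajMap A B C D (x, u) k = trajMap A B C D (x, u') k := by
  change Sum.elim (u k) (C *ᵥ stateMap A B k (x, u) + D *ᵥ u k) =
    Sum.elim (u' k) (C *ᵥ stateMap A B k (x, u') + D *ᵥ u' k)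
  rw [stateMap_congr A B h k hk.le, h k hk]

theorem extendInput_of_lt {T : ℕ} (u : Fin T → Fin m → ℝ) {k : ℕ} (h : k < T) :
    extendInput T u k = u ⟨k, h⟩ := dif_pos h

theorem windowMap_restrict (T : ℕ) (x : Fin N → ℝ) (u : ℕ → Fin m → ℝ) :
    windowMap A B C D T (x, fun t => u t) =
      fun a => trajMap A B C D (x, u) a.1 a.2 := by
  ext a
  refine congrFun (trajMap_congr A B C D (T := T) (fun k hk => ?_) a.1.isLt) a.2
  exact extendInput_of_lt _ hk

theorem range_windowMap (T : ℕ) :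
    Set.range (windowMap A B C D T) = Function.uncurry '' restrict (ssBehavior A B C D) T := by
  rw [← range_trajMap, restrict, ← Set.range_comp, ← Set.range_comp]
  ext v
  constructor
  · rintro ⟨z, rfl⟩
    exact ⟨(z.1, extendInput T z.2), rfl⟩
  · rintro ⟨⟨x, u⟩, rfl⟩
    exact ⟨(x, fun t => u t), windowMap_restrict A B C D T x u⟩

theorem ssBehavior_shift {w : ℕ → Sig m p → ℝ} (hw : w ∈ ssBehavior A B C D) (j : ℕ) :
    (fun k => w (j + k)) ∈ ssBehavior A B C D := by
  obtain ⟨x, hx⟩ := hw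
  exact ⟨fun k => x (j + k), fun k => hx (j + k)⟩

theorem finrank_windowMap_domain (T : ℕ) :
    Module.finrank ℝ ((Fin N → ℝ) × (Fin T → Fin m → ℝ)) = m * T + N := by
  rw [Module.finrank_prod, Module.finrank_fintype_fun_eq_card, Module.finrank_pi_fintype]
  simp only [Module.finrank_fintype_fun_eq_card, Fintype.card_fin, Finset.sum_const,
    Finset.card_univ, smul_eq_mul]
  ring

/-- A window length at which the initial state and the input are observable stays so when it is
increased. -/
theorem windowMap_injective_mono {d M : ℕ} (hdM : d ≤ M)
    (h : Function.Injective (windowMap A B C D d)) :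
    Function.Injective (windowMap A B C D M) := by
  rw [injective_iff_map_eq_zero] at h ⊢
  rintro ⟨x, u⟩ hxu
  have hu : u = 0 := by
    ext t i
    have := congrFun hxu (t, Sum.inl i)
    change extendInput M u t i = 0 at this
    rw [extendInput_of_lt _ t.isLt] at this
    exact this
  subst hu
  have hx : windowMap A B C D d (x, 0) = 0 := by
    have e1 := windowMap_restrict A B C D d x 0
    have e2 := windowMap_restrict A B C D M x 0
    have e3 : windowMap A B C D M (x, fun _ => 0) = 0 := hxu
    refine e1.trans ?_
    ext a
    have := congrFun (e2.symm.trans e3) (⟨a.1, by have := a.1.isLt; omega⟩, a.2)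
    exact this
  have := h _ hx
  simp only [Prod.mk_eq_zero] at this
  rw [this.1]; rfl

variable {T d : ℕ} {w : Fin T → Sig m p → ℝ}

theorem range_hankel_le (hw : w ∈ restrict (ssBehavior A B C D) T) :
    LinearMap.range (hankel d w).mulVecLin ≤ LinearMap.range (windowMap A B C D d) := by
  obtain ⟨v, hv, rfl⟩ := hw
  rintro _ ⟨c, rfl⟩
  rw [mulVecLin_apply, mulVec_eq_sum]
  refine Submodule.sum_mem _ fun j _ => ?_
  rw [op_smul_eq_smul]
  refine Submodule.smul_mem _ _ ?_
  change _ ∈ Set.range (windowMap A B C D d)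
  rw [range_windowMap]
  exact ⟨_, ⟨_, ssBehavior_shift A B C D hv j, rfl⟩, rfl⟩

/-- If the Hankel matrix has rank `md + N`, its columns span all windows of length `d`. -/
theorem range_hankel_eq (hw : w ∈ restrict (ssBehavior A B C D) T)
    (hr : (hankel d w).rank = m * d + N) :
    LinearMap.range (hankel d w).mulVecLin = LinearMap.range (windowMap A B C D d) := by
  refine Submodule.eq_of_le_of_finrank_le (range_hankel_le A B C D hw) ?_
  have := LinearMap.finrank_range_le (windowMap A B C D d)
  rw [finrank_windowMap_domain, ← hr] at this
  exact this

theorem windowMap_injective (hw : w ∈ restrict (ssBehavior A B C D) T)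
    (hr : (hankel d w).rank = m * d + N) :
    Function.Injective (windowMap A B C D d) := by
  rw [← LinearMap.ker_eq_bot, ← Submodule.finrank_eq_zero]
  have h := LinearMap.finrank_range_add_finrank_ker (windowMap A B C D d)
  have h2 : Module.finrank ℝ (LinearMap.range (hankel d w).mulVecLin) = m * d + N := hr
  rw [← range_hankel_eq A B C D hw hr, finrank_windowMap_domain, h2] at h
  omega

theorem range_windowMap_le_ker_gammaMat {M g : ℕ} (hdM : d ≤ M)
    (hw : w ∈ restrict (ssBehavior A B C D) T) (hr : (hankel d w).rank = m * d + N)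
    {R : Matrix (Fin g) (Fin d × Sig m p) ℝ} (hR : R * hankel d w = 0) :
    LinearMap.range (windowMap A B C D M) ≤ LinearMap.ker (gammaMat M R).mulVecLin := by
  have hker : ∀ v ∈ ssBehavior A B C D, ∀ i, (R i ⬝ᵥ fun b => v b.1 b.2) = 0 := by
    intro v hv i
    have h1 : (fun b : Fin d × Sig m p => v b.1 b.2) ∈ Set.range (windowMap A B C D d) := by
      rw [range_windowMap]
      exact ⟨_, ⟨v, hv, rfl⟩, rfl⟩
    have h2 : (fun b : Fin d × Sig m p => v b.1 b.2) ∈ LinearMap.range (hankel d w).mulVecLin := by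
      rw [range_hankel_eq A B C D hw hr]; exact h1
    obtain ⟨c, hc⟩ := h2
    rw [← hc]
    have := congrFun (mulVec_mulVec c R (hankel d w)) i
    rw [hR, zero_mulVec] at this
    exact this
  intro y hy
  have hy' : y ∈ Set.range (windowMap A B C D M) := hy
  rw [range_windowMap] at hy'
  obtain ⟨_, ⟨v, hv, rfl⟩, rfl⟩ := hy'
  rw [LinearMap.mem_ker]
  have hs : ∀ s i, s + d ≤ M → shiftedRow M R s i ⬝ᵥ
      (Function.uncurry fun t : Fin M => v t) = 0 := by
    intro s i hsM
    rw [shiftedRow_dotProduct hsM]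
    exact hker _ (ssBehavior_shift A B C D hv s) i
  ext a
  rcases a with i | ⟨s, i⟩
  · exact hs 0 i (by omega)
  · exact hs (s + 1) i (by omega)

/-- If the kernel of `Γ(R)` has dimension at most `m M + N`, it is the set of all windows of
length `M`. -/
theorem range_windowMap_eq_ker_gammaMat {M g : ℕ} (hdM : d ≤ M)
    (hw : w ∈ restrict (ssBehavior A B C D) T) (hr : (hankel d w).rank = m * d + N)
    {R : Matrix (Fin g) (Fin d × Sig m p) ℝ} (hR : R * hankel d w = 0)
    (hΓ : Module.finrank ℝ (LinearMap.ker (gammaMat M R).mulVecLin) ≤ m * M + N) :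
    LinearMap.range (windowMap A B C D M) = LinearMap.ker (gammaMat M R).mulVecLin := by
  refine Submodule.eq_of_le_of_finrank_le (range_windowMap_le_ker_gammaMat A B C D hdM hw hr hR) ?_
  rwa [LinearMap.finrank_range_of_inj
    (windowMap_injective_mono A B C D hdM (windowMap_injective A B C D hw hr)),
    finrank_windowMap_domain]

end Behavior

/-! ### The perturbation bound -/

theorem frobenius_norm_le_of_abs_le {ι κ : Type} [Fintype ι] [Fintype κ] {M : Matrix ι κ ℝ}
    {c : ℝ} (hc : 0 ≤ c) (h : ∀ i j, |M i j| ≤ c) :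
    ‖M‖ ≤ √((Fintype.card ι : ℝ) * Fintype.card κ) * c := by
  refine le_of_sq_le_sq ?_ (by positivity)
  rw [mul_pow, Real.sq_sqrt (by positivity), frobenius_sq]
  have h1 : ∑ i, ∑ j, M i j ^ 2 ≤ ∑ _i : ι, ∑ _j : κ, c ^ 2 :=
    Finset.sum_le_sum fun i _ => Finset.sum_le_sum fun j _ => sq_le_sq' (abs_le.1 (h i j)).1
      (abs_le.1 (h i j)).2
  refine h1.trans_eq ?_
  simp only [Finset.sum_const, Finset.card_univ, nsmul_eq_mul]
  ring

theorem norm_hankel_addOutputNoise_sub_le {m p T d : ℕ} (w : Fin T → Sig m p → ℝ)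
    (ε : Fin T → Fin p → ℝ) {εbar : ℝ} (hε : ∀ k, ‖ε k‖ ≤ εbar) (h0 : 0 ≤ εbar) (hT : d ≤ T) :
    ‖hankel d (addOutputNoise w ε) - hankel d w‖ ≤
      √(((m : ℝ) + p) * d * ((T : ℝ) - d + 1)) * εbar := by
  refine (frobenius_norm_le_of_abs_le h0 fun a j => ?_).trans_eq ?_
  · rw [Matrix.sub_apply]
    rcases a with ⟨t, v | v⟩
    · simpa [hankel, addOutputNoise] using h0
    · have := (norm_le_pi_norm (ε ⟨j + t, by omega⟩) v).trans (hε _)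
      simpa [hankel, addOutputNoise] using this
  · rw [Fintype.card_prod, Fintype.card_sum, Fintype.card_fin, Fintype.card_fin, Fintype.card_fin,
      Fintype.card_fin]
    congr 2
    push_cast [Nat.cast_sub (show d ≤ T + 1 by omega)]
    ring

/-- Columns at Frobenius distance less than `1` from orthonormal columns are linearly
independent. -/
theorem mulVec_injective_of_near {ι γ : Type} [Fintype ι] [Fintype γ] [DecidableEq γ]
    {N P : Matrix ι γ ℝ} (hN : Nᵀ * N = 1) (h : ‖N - P‖ < 1) : Function.Injective P.mulVec := by
  have hinj : Function.Injective P.mulVecLin := by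
    rw [injective_iff_map_eq_zero]
    intro c hc
    have h1 := mulVec_dotProduct_self_le (N - P) c
    have h2 : P *ᵥ c = 0 := hc
    rw [sub_mulVec, h2, sub_zero, mulVec_dotProduct_self_of_orthonormal hN] at h1
    have h3 : ‖N - P‖ ^ 2 < 1 := by nlinarith [norm_nonneg (N - P)]
    have h4 := dotProduct_self_nonneg_real c
    have h5 : c ⬝ᵥ c = 0 := by nlinarith
    exact dotProduct_self_eq_zero.1 h5
  exact hinj

theorem rank_add_finrank_ker {ι κ : Type} [Fintype ι] [Fintype κ] (M : Matrix ι κ ℝ) :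
    M.rank + Module.finrank ℝ (LinearMap.ker M.mulVecLin) = Fintype.card κ := by
  have h := LinearMap.finrank_range_add_finrank_ker M.mulVecLin
  rwa [Module.finrank_fintype_fun_eq_card] at h

/-- `Γ` has at most `(pd - n) + p (M - d) = pM - n` rows; there may be fewer when `pd - n < p`. -/
theorem rank_gammaMat_le {m p n d M : ℕ} (hdM : d ≤ M) (hn : n ≤ p * d)
    (R : Matrix (Fin (p * d - n)) (Fin d × Sig m p) ℝ) : (gammaMat M R).rank ≤ p * M - n := by
  refine (rank_le_card_height _).trans (card_gammaMat_rows_le.trans ?_)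
  obtain ⟨c, rfl⟩ := Nat.exists_eq_add_of_le hdM
  rw [Nat.add_sub_cancel_left, Nat.mul_add, Nat.mul_comm c p]
  omega

theorem tendsto_basisErrorBound {m p n d L T : ℕ} {sΓ sH : ℝ} (hH : sH ≠ 0) :
    Tendsto (fun e => basisErrorBound m p n d L T sΓ sH e) (𝓝 0) (𝓝 0) := by
  have h : ContinuousAt (fun e => basisErrorBound m p n d L T sΓ sH e) 0 := by
    unfold basisErrorBound
    refine ContinuousAt.mul (ContinuousAt.div continuousAt_const (by fun_prop) ?_) continuousAt_id
    simpa using hH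
  have h2 := h.tendsto
  simpa [basisErrorBound] using h2

/-- The matching inequality turns the bound on the principal angles into one on
`‖Γ(Rhat) - Γ(R)‖`. The condition `2 * e ≤ sv H r` is what replaces the denominator
`sv H r - e` of Wedin's theorem by `sv H r / 2`. -/
theorem sv_mul_norm_gammaMat_sub_le {m p d M g r : ℕ} {κ : Type} [Fintype κ] [DecidableEq κ]
    {H Mnoisy Hhat : Matrix (Fin d × Sig m p) κ ℝ} {Rhat R : Matrix (Fin g) (Fin d × Sig m p) ℝ}
    (hdM : d ≤ M) (hTSVD : IsTSVD r Mnoisy Hhat) (hr : 0 < r) (hH : H.rank = r)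
    (hR : IsMatchedLeftNull r Hhat H Rhat R) {e : ℝ} (he : ‖Mnoisy - H‖ ≤ e)
    (hgap : 2 * e ≤ sv H r) (hpos : 0 < sv H r) :
    sv H r * ‖gammaMat M Rhat - gammaMat M R‖ ≤ 4 * √((M : ℝ) - d + 1) * √(r : ℝ) * e := by
  obtain ⟨-, θ, hθ, hmatch⟩ := hR
  have hE := norm_nonneg (Mnoisy - H)
  have hsin := norm_sin_le_of_isTSVD hTSVD hr hH (by linarith) hθ
  set S := ‖diagonal (fun i => Real.sin (θ i))‖
  have hS0 : 0 ≤ S := norm_nonneg _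
  have hS : sv H r * S ≤ 2 * e := by nlinarith
  have hK : (0 : ℝ) ≤ (M : ℝ) - d + 1 := by
    have : (d : ℝ) ≤ M := by exact_mod_cast hdM
    linarith
  have hΓ : ‖gammaMat M Rhat - gammaMat M R‖ ≤ √((M : ℝ) - d + 1) * ‖Rhat - R‖ := by
    refine le_of_sq_le_sq ?_ (by positivity)
    rw [mul_pow, Real.sq_sqrt hK, gammaMat_sub]
    exact norm_gammaMat_sq_le hdM _
  calc sv H r * ‖gammaMat M Rhat - gammaMat M R‖
      ≤ sv H r * (√((M : ℝ) - d + 1) * (2 * √(r : ℝ) * S)) := by gcongr; exact hΓ.trans (by gcongr)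
    _ = 2 * √((M : ℝ) - d + 1) * √(r : ℝ) * (sv H r * S) := by ring
    _ ≤ 2 * √((M : ℝ) - d + 1) * √(r : ℝ) * (2 * e) := by gcongr
    _ = _ := by ring

theorem le_of_two_step_bound {x Δ s t D q c e : ℝ} (hs : 0 < s) (hD : 0 < D) (hDt : D ≤ t)
    (hq : 1 ≤ q) (hc : 0 ≤ c) (he : 0 ≤ e) (hx : s * x ≤ Δ) (hΔ : t * Δ ≤ 4 * c * e) :
    x ≤ 2 * q * (8 * c) / s / D * e := by
  have ht : 0 < t := hD.trans_le hDt
  have hnum : 4 * c / s ≤ 2 * q * (8 * c) / s := by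
    refine div_le_div_of_nonneg_right ?_ hs.le
    nlinarith
  calc x ≤ Δ / s := by rwa [le_div_iff₀ hs, mul_comm]
    _ ≤ 4 * c * e / t / s := by
      refine div_le_div_of_nonneg_right ?_ hs.le
      rwa [le_div_iff₀ ht, mul_comm]
    _ = 4 * c / s / t * e := by ring
    _ ≤ 2 * q * (8 * c) / s / D * e :=
      mul_le_mul_of_nonneg_right (div_le_div₀ (by positivity) hnum hD hDt) he

theorem corollary2 (m p n l d L T : ℕ)
    -- the true system and a noise-free trajectory
    (𝓑 : Set (ℕ → Sig m p → ℝ)) (h𝓑 : IsLTI m p n l 𝓑)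
    (w : Fin T → Sig m p → ℝ) (hw : w ∈ restrict 𝓑 T)
    -- bounded output noise
    (ε : Fin T → Fin p → ℝ) (εbar : ℝ) (hε : ∀ k, ‖ε k‖ ≤ εbar)
    (hd : l + 1 ≤ d) (hL : d ≤ L) (hT : d ≤ T)
    (hrank : (hankel d w).rank = m * d + n)
    (hrank' : (hankel d w).rank ≤ (hankel d (addOutputNoise w ε)).rank)
    -- truncated SVD of the noisy Hankel matrix, followed by the preprocessing algorithm
    (Hhat : Matrix (Fin d × Sig m p) (Fin (T + 1 - d)) ℝ)
    (hHhat : IsTSVD (m * d + n) (hankel d (addOutputNoise w ε)) Hhat)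
    (Rhat : Matrix (Fin (p * d - n)) (Fin d × Sig m p) ℝ) (hRhat : IsNull Rhatᵀ Hhatᵀ)
    (k : ℕ) (Phat : Matrix (Fin (L + n) × Sig m p) (Fin k) ℝ)
    (hPhat : IsNull Phat (gammaMat (L + n) Rhat)) :
    -- matched noise-free matrices `R` exist, and for each of them the bound holds
    (∃ R : Matrix (Fin (p * d - n)) (Fin d × Sig m p) ℝ,
      IsMatchedLeftNull (m * d + n) Hhat (hankel d w) Rhat R) ∧
    ∀ R : Matrix (Fin (p * d - n)) (Fin d × Sig m p) ℝ,
      IsMatchedLeftNull (m * d + n) Hhat (hankel d w) Rhat R →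
      ∀ sΓ sH : ℝ, sΓ = sv (gammaMat (L + n) R) (p * (L + n) - n) →
      sH = sv (hankel d w) (m * d + n) →
      0 < sΓ →
      (rho1 m p n d L T / sΓ + rho2 m p d T) * εbar < sH →
      (∃ P : Matrix (Fin (L + n) × Sig m p) (Fin k) ℝ,
        LinearIndependent ℝ (fun j => P.col j) ∧
        Set.range P.mulVec = Function.uncurry '' restrict 𝓑 (L + n) ∧
        ‖Phat - P‖ ≤ basisErrorBound m p n d L T sΓ sH εbar) ∧
      Tendsto (fun e => basisErrorBound m p n d L T sΓ sH e) (𝓝 0) (𝓝 0) := by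
  obtain ⟨⟨A, B, C, D, rfl⟩, -⟩ := h𝓑.order
  have hn : n ≤ p * d := by
    have h := rank_le_card_height (hankel d w)
    rw [hrank, Fintype.card_prod, Fintype.card_sum] at h
    simp only [Fintype.card_fin] at h
    nlinarith
  have hcard : p * d - n + (m * d + n) = Fintype.card (Fin d × Sig m p) := by
    rw [Fintype.card_prod, Fintype.card_sum]
    simp only [Fintype.card_fin]
    rw [Nat.mul_add, Nat.mul_comm d m, Nat.mul_comm d p]
    omega
  refine ⟨exists_isMatchedLeftNull hRhat hrank hcard, ?_⟩
  intro R hR sΓ sH hsΓ hsH hΓpos hgap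
  have hdM : d ≤ L + n := by omega
  have hε0 : 0 ≤ εbar := (norm_nonneg _).trans (hε ⟨0, by omega⟩)
  have hKc : ((L + n : ℕ) : ℝ) - d + 1 = (L : ℝ) + n - d + 1 := by push_cast; ring
  have hrc : ((m * d + n : ℕ) : ℝ) = (m : ℝ) * d + n := by push_cast; ring
  set K : ℝ := (L : ℝ) + n - d + 1 with hK
  set r : ℝ := (m : ℝ) * d + n with hr
  set Q : ℝ := ((m : ℝ) + p) * d * ((T : ℝ) - d + 1) with hQ
  have hK0 : 0 ≤ K := by
    have : (d : ℝ) ≤ (L + n : ℕ) := by exact_mod_cast hdM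
    push_cast at this
    linarith
  have hr0 : 0 ≤ r := by positivity
  have hQ0 : 0 ≤ Q := by
    have : (d : ℝ) ≤ T := by exact_mod_cast hT
    have : 0 ≤ (T : ℝ) - d + 1 := by linarith
    positivity
  have eρ2 : rho2 m p d T = 2 * √Q := rfl
  have eρ1 : rho1 m p n d L T = 4 * √K * (√2 * (√r * √Q)) := by
    rw [← Real.sqrt_mul hr0, ← Real.sqrt_mul zero_le_two, rho1]
    congr 2
    rw [hQ, hr]; ring
  have eC : Ctheta m p n d L T = 8 * (√K * √r * √Q) := by
    rw [← Real.sqrt_mul hK0, ← Real.sqrt_mul (mul_nonneg hK0 hr0), Ctheta]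
    congr 2
    rw [hQ, hr, hK]; ring
  have hρ1 : 0 ≤ rho1 m p n d L T / sΓ * εbar := by rw [eρ1]; positivity
  have hρ2 : 0 ≤ √Q * εbar := by positivity
  rw [add_mul] at hgap
  have hgap1 : rho1 m p n d L T / sΓ * εbar < sH := by rw [eρ2] at hgap; linarith
  have hgap2 : 2 * (√Q * εbar) < sH := by rw [eρ2] at hgap; linarith
  have hHpos : 0 < sH := by linarith
  have hrpos : 0 < m * d + n := by
    have := sub_one_lt_rank_of_sv_pos (hsH ▸ hHpos)
    omega
  refine ⟨?_, tendsto_basisErrorBound hHpos.ne'⟩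
  -- The distance of the two matrices `Γ` is smaller than `sΓ`.
  have hΔ := sv_mul_norm_gammaMat_sub_le hdM hHhat hrpos hrank hR
    (norm_hankel_addOutputNoise_sub_le w ε hε hε0 hT) (hsH ▸ hgap2.le) (hsH ▸ hHpos)
  rw [← hsH, hKc, hrc] at hΔ
  set Δ := ‖gammaMat (L + n) Rhat - gammaMat (L + n) R‖
  have hΔΓ : Δ < sΓ := by
    have h2 : (1 : ℝ) ≤ √2 := Real.one_le_sqrt.2 one_le_two
    have h1 : sH * Δ ≤ rho1 m p n d L T * εbar := by
      refine hΔ.trans ?_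
      have h3 : 0 ≤ 4 * √K * √r * (√Q * εbar) := by positivity
      rw [eρ1]
      nlinarith
    have h3 : rho1 m p n d L T * εbar < sH * sΓ := by
      rw [div_mul_eq_mul_div, div_lt_iff₀ hΓpos] at hgap1
      exact hgap1
    exact lt_of_mul_lt_mul_left (h1.trans_lt h3) hHpos.le
  -- The kernel of `Γ(R)` consists of the windows of the system.
  have hRH : R * hankel d w = 0 := by
    have := congrArg transpose hR.1.mul_eq_zero
    simpa using this
  have hcardM : Fintype.card (Fin (L + n) × Sig m p) = m * (L + n) + p * (L + n) := by
    rw [Fintype.card_prod, Fintype.card_sum]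
    simp only [Fintype.card_fin]
    ring
  have hnM : n ≤ p * (L + n) := hn.trans (Nat.mul_le_mul_left p hdM)
  have hkerΓ : Module.finrank ℝ (LinearMap.ker (gammaMat (L + n) R).mulVecLin) ≤
      m * (L + n) + n := by
    have h1 := rank_add_finrank_ker (gammaMat (L + n) R)
    have h2 := sub_one_lt_rank_of_sv_pos (hsΓ ▸ hΓpos)
    omega
  have hkeq := range_windowMap_eq_ker_gammaMat A B C D hdM hw hrank hRH hkerΓ
  have hk : m * (L + n) + n ≤ k := by
    have h1 := rank_add_finrank_ker (gammaMat (L + n) Rhat)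
    have h2 := rank_gammaMat_le hdM hn Rhat
    have h3 := hPhat.finrank_ker
    rw [Fintype.card_fin] at h3
    omega
  obtain ⟨P, hΓP, hPnear⟩ := exists_mul_eq_zero_near (gammaMat (L + n) R)
    (gammaMat (L + n) Rhat) (rank_gammaMat_le hdM hn R) Phat hPhat.1 hPhat.mul_eq_zero
  rw [← hsΓ] at hPnear
  have hinj : Function.Injective P.mulVec := by
    refine mulVec_injective_of_near hPhat.1 ?_
    exact lt_of_mul_lt_mul_left ((hPnear.trans_lt hΔΓ).trans_eq (mul_one _).symm) hΓpos.le
  refine ⟨P, mulVec_injective_iff.1 hinj, ?_, ?_⟩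
  · rw [← range_windowMap A B C D]
    have hle : LinearMap.range P.mulVecLin ≤
        LinearMap.ker (gammaMat (L + n) R).mulVecLin := by
      rintro _ ⟨c, rfl⟩
      rw [LinearMap.mem_ker, mulVecLin_apply, mulVecLin_apply, mulVec_mulVec, hΓP, zero_mulVec]
    have heq := Submodule.eq_of_le_of_finrank_le hle (by
      rw [LinearMap.finrank_range_of_inj (f := P.mulVecLin) hinj,
        Module.finrank_fintype_fun_eq_card, Fintype.card_fin]
      exact hkerΓ.trans hk)
    have h1 := congrArg SetLike.coe (heq.trans hkeq.symm)
    exact h1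
  · have hk1 : (1 : ℝ) ≤ √((m : ℝ) * ((L : ℝ) + n) + n) := by
      rw [Real.one_le_sqrt]
      have h1 : 0 < m * (L + n) + n := by
        rcases Nat.eq_zero_or_pos n with h | h
        · have hm : 0 < m := Nat.pos_of_ne_zero fun hm => by simp [hm, h] at hrpos
          have := Nat.mul_pos hm (show 0 < L + n by omega)
          omega
        · omega
      exact_mod_cast h1
    set q := √((m : ℝ) * ((L : ℝ) + n) + n)
    set c := √K * √r * √Q with hc
    have hc0 : 0 ≤ c := by positivity
    have hden : 0 < sH - (rho1 m p n d L T / sΓ + rho2 m p d T) * εbar := by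
      rw [add_mul]
      exact sub_pos.2 hgap
    have hden' : sH - (rho1 m p n d L T / sΓ + rho2 m p d T) * εbar ≤ sH := by
      rw [add_mul, eρ2]; linarith
    have h1 := le_of_two_step_bound hΓpos hden hden' hk1 hc0 hε0 hPnear
      (hΔ.trans_eq (by rw [hc]; ring))
    rw [← eC] at h1
    exact h1
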